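/- **Conventions.** Let $\mathbb K=\mathbb R$ or $\mathbb C$; all vector spaces are finite dimensional over $\mathbb K$, $\langle\,,\rangle$ is the pairing of a space with its dual, $\mathrm{ad}^*_x$ is the transpose of $\mathrm{ad}_x$, and $\mathrm{Cycl}_{(\xi,\eta,\zeta)}$ is the sum over cyclic permutations of $(\xi,\eta,\zeta)$. "Smooth" and "analytic" mean over $\mathbb K$. A *Lie quasi-bialgebra* $\mathcal G=(\mathfrak g,[\,,],\varpi,\varphi)$ is a Lie algebra $\mathfrak g$ with a linear map $x\mapsto\varpi_x$ from $\mathfrak g$ to the skew-symmetric linear maps $\mathfrak g^*\to\mathfrak g$ satisfying $\varpi_{[x,y]}=\mathrm{ad}_x\varpi_y+\varpi_y\mathrm{ad}_x^*-\mathrm{ad}_y\varpi_x-\varpi_x\mathrm{ad}_y^*$, and an element $\varphi\in\wedge^3\mathfrak g$ (regarded as an alternating trilinear form on $\mathfrak g^*$), such that the bracket $$[x,y]_{\mathfrak d}=[x,y],\qquad [x,\xi]_{\mathfrak d}=\varpi_x\xi-\mathrm{ad}^*_x\xi,\qquad [\xi,\eta]_{\mathfrak d}=\langle\eta,\varpi_\bullet\xi\rangle+\langle\xi\otimes\eta\otimes1,\varphi\rangle\qquad(x,y\in\mathfrak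 g,\ \xi,\eta\in\mathfrak g^*)$$ makes $\mathfrak d=\mathfrak g\oplus\mathfrak g^*$ a Lie algebra, the *double* of $\mathcal G$. Write $\mathrm{ad}^{\mathfrak d}$ for its adjoint action and $\mathrm{Ad}^{\mathfrak d}_{e^{X}}=\exp(\mathrm{ad}^{\mathfrak d}_X)$. Let $\mathfrak l\subset\mathfrak g$ be a Lie subalgebra with inclusion $i$, let $L$ be a connected Lie group with Lie algebra $\mathfrak l$, and let $U\subset\mathfrak l^*$ be open and $\mathrm{Ad}^*_L$-invariant. A *dynamical $\ell$-matrix on $U$ associated with $\mathcal G$* is a smooth map $p\mapsto l_p$ from $U$ to the skew-symmetric linear maps $\mathfrak g^*\to\mathfrak g$ such that, for all $p\in U$, $\xi,\eta,\zeta\in\mathfrak g^*$ and $z\in\mathfrak l$, $$\mathrm{Cycl}_{(\xi,\eta,\zeta)}\Big(\langle\zeta,d_pl(i^*\xi)\eta\rangle-\langle\zeta,[l_p\xi,l_p\eta]\rangle-\langle\zeta,\varpi_{l_p\xi}\eta\rangle\Big)=\langle\xi\otimes\eta\otimes\zeta,\varphi\rangle,$$ $$d_pl(\mathrm{ad}^*_zp)+\varpi_{iz}+\mathrm{ad}_{iz}l_p+l_p\,\mathrm{ad}^*_{iz}=0\qquad(\mathfrak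 l\text{-equivariance}).$$ Let $\mathfrak g=\mathfrak l\oplus\mathfrak m$ be a *reductive decomposition*: $\mathfrak l$ is a Lie subalgebra, $\mathfrak m$ a complementary subspace, and $[\mathfrak l,\mathfrak m]\subset\mathfrak m$. Let $\mathfrak l^\perp,\mathfrak m^\perp\subset\mathfrak g^*$ be the annihilators, $p_{\mathfrak l}:\mathfrak g\to\mathfrak l$ the projection along $\mathfrak m$, $s=(p_{\mathfrak l})^*:\mathfrak l^*\to\mathfrak g^*$ (with image $\mathfrak m^\perp$, so $\mathfrak g^*=s\mathfrak l^*\oplus\mathfrak l^\perp$), and $p_{\mathfrak g}:\mathfrak d\to\mathfrak g$, $i_{\mathfrak g}:\mathfrak g\to\mathfrak d$ the projection along $\mathfrak g^*$ and the inclusion. A Lie quasi-bialgebra $\mathcal G$ is *canonically compatible* with the decomposition if $\varpi_x=0$ for $x\in\mathfrak l$; $\langle\xi,\varpi_x\eta\rangle=0$ for $x\in\mathfrak g$ and $\xi,\eta\in\mathfrak m^\perp$; and $\varphi$ has vanishing components in $\wedge^2\mathfrak l\otimes\mathfrak m$ and in $\wedge^3\mathfrak m$ with respect to $\wedge^3\mathfrak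 g=\wedge^3\mathfrak l\oplus(\wedge^2\mathfrak l\otimes\mathfrak m)\oplus(\mathfrak l\otimes\wedge^2\mathfrak m)\oplus\wedge^3\mathfrak m$. **Theorem.** Let $\mathcal G=(\mathfrak g,[\,,],\varpi,\varphi)$ be a Lie quasi-bialgebra canonically compatible with a reductive decomposition $\mathfrak g=\mathfrak l\oplus\mathfrak m$, with double $\mathfrak d$. Then $(\mathfrak l,[\,,]_{\mathfrak l},0,p_{\mathfrak l}^{(3)}\varphi)$ is a Lie quasi-bialgebra; let $\mathfrak l\oplus\mathfrak l^*$ be its double. The set $$U=\Big\{p\in\mathfrak l^*:\ \mathrm{Spec}\big(\mathrm{ad}_p^{\mathfrak l\oplus\mathfrak l^*}\big)\cap i\pi\mathbb Z^*=\emptyset\ \text{ and }\ 0\notin\mathrm{Spec}\big(p_{\mathfrak g}\mathrm{Ad}^{\mathfrak d}_{e^{-sp}}i_{\mathfrak g}\big)\Big\}$$ (complex spectra, $\mathbb Z^*=\mathbb Z\setminus\{0\}$) is an open, $\mathrm{Ad}^*_L$-invariant subset of $\mathfrak l^*$ containing $0$. For $p\in U$ define $l^{\mathrm{can}}_p:\mathfrak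 g^*\to\mathfrak g$ by $$l^{\mathrm{can}}_p(s\alpha+\xi)=r^{\mathrm{AM}}_p\alpha-\big(p_{\mathfrak g}\mathrm{Ad}^{\mathfrak d}_{e^{-sp}}i_{\mathfrak g}\big)^{-1}p_{\mathfrak g}\mathrm{Ad}^{\mathfrak d}_{e^{-sp}}\xi\qquad(\alpha\in\mathfrak l^*,\ \xi\in\mathfrak l^\perp),$$ where $r^{\mathrm{AM}}_p=F\big(\mathrm{ad}_p^{\mathfrak l\oplus\mathfrak l^*}\big)\big|_{\mathfrak l^*}:\mathfrak l^*\to\mathfrak l$ with $F(z)=\coth z-\tfrac1z$, $F(0)=0$. Then $l^{\mathrm{can}}$ is a dynamical $\ell$-matrix on $U$ associated with $\mathcal G$; it is analytic on $U$; $l^{\mathrm{can}}_0=0$; and it is compatible with the decomposition, that is, $l^{\mathrm{can}}_p\mathfrak m^\perp\subset\mathfrak l$ and $l^{\mathrm{can}}_p\mathfrak l^\perp\subset\mathfrak m$ for all $p\in U$. -/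

import Mathlib

open Module Topology
open scoped ContDiff

noncomputable section

namespace LieQuasi

/-! ### Functional calculus for endomorphisms of finite-dimensional spaces -/

section FunctionalCalculus

/-- The inclusion of the scalar field `K` (`ℝ` or `ℂ`) into `ℂ`, `z ↦ re z + im z * I`. -/
def toComplex (K : Type*) [RCLike K] : K →+* ℂ where
  toFun := RCLike.map K ℂ
  map_one' := by simp
  map_zero' := by simp
  map_add' := by intro x y; exact map_add _ x y
  map_mul' := by
    intro x y
    apply Complex.ext <;> simp [RCLike.mul_re, RCLike.mul_im]

variable {K : Type*} [RCLike K] {V : Type*} [AddCommGroup V] [Module K V] [FiniteDimensional K V]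

/-- The spectrum in `ℂ` of an endomorphism of a finite-dimensional real or complex vector space:
the set of complex roots of its characteristic polynomial. -/
def complexSpectrum (f : End K V) : Set ℂ :=
  {z | (f.charpoly.map (toComplex K)).IsRoot z}

/-- The set `iπℤ*` of the nonzero integer multiples of `iπ`. -/
def nonzeroMultiplesOfIPi : Set ℂ :=
  {z | ∃ k : ℤ, k ≠ 0 ∧ z = Complex.I * Real.pi * k}

/-- The endomorphism `∑ₙ aₙ fⁿ`; the sum is taken in the canonical (Hausdorff vector space)
topology of the finite-dimensional space `End K V`. It is used for entire series only. -/
def powerSeriesEnd (a : ℕ → K) (f : End K V) : End K V :=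
  letI : TopologicalSpace (End K V) := moduleTopology K (End K V)
  ∑' n : ℕ, a n • f ^ n

/-- The exponential of an endomorphism. -/
def expEnd (f : End K V) : End K V := powerSeriesEnd (fun n => ((n.factorial : ℕ) : K)⁻¹) f

/-- Coefficients of the entire function
`(z * cosh z - sinh z) / z ^ 2 = ∑_{n odd} (n + 1) / (n + 2).factorial * z ^ n`. -/
def numCoeff (K : Type*) [RCLike K] (n : ℕ) : K :=
  if Odd n then ((n + 1 : ℕ) : K) / (((n + 2).factorial : ℕ) : K) else 0

/-- Coefficients of the entire function `sinh z / z = ∑_{n even} 1 / (n + 1).factorial * z ^ n`. -/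
def denCoeff (K : Type*) [RCLike K] (n : ℕ) : K :=
  if Even n then (((n + 1).factorial : ℕ) : K)⁻¹ else 0

/-- The two entire series above have quotient `coth z - 1 / z`. -/
theorem num_div_den (z : ℂ) (hz : z ≠ 0) (hs : Complex.sinh z ≠ 0) :
    (∑' n, numCoeff ℂ n * z ^ n) / (∑' n, denCoeff ℂ n * z ^ n)
      = Complex.cosh z / Complex.sinh z - 1 / z := by
  have hD : HasSum (fun n => denCoeff ℂ n * z ^ n) (Complex.sinh z / z) := by
    have h1 : HasSum (fun k : ℕ => denCoeff ℂ (2 * k) * z ^ (2 * k)) (Complex.sinh z / z) := by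
      have h := (Complex.hasSum_sinh z).div_const z
      have e : (fun k : ℕ => denCoeff ℂ (2 * k) * z ^ (2 * k))
          = fun k : ℕ => z ^ (2 * k + 1) / (((2 * k + 1).factorial : ℕ) : ℂ) / z := by
        funext k
        simp only [denCoeff, even_two_mul, if_true, pow_succ]
        field_simp
      rw [e]
      exact h
    have h2 : HasSum (fun k : ℕ => denCoeff ℂ (2 * k + 1) * z ^ (2 * k + 1)) 0 := by
      have : (fun k : ℕ => denCoeff ℂ (2 * k + 1) * z ^ (2 * k + 1)) = fun _ => 0 := by
        funext k
        simp [denCoeff]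
      rw [this]
      exact hasSum_zero
    have h3 := HasSum.even_add_odd (f := fun n => denCoeff ℂ n * z ^ n) h1 h2
    rwa [add_zero] at h3
  have hN : HasSum (fun n => numCoeff ℂ n * z ^ n)
      ((z * Complex.cosh z - Complex.sinh z) / z ^ 2) := by
    have h1 : HasSum (fun k : ℕ => numCoeff ℂ (2 * k) * z ^ (2 * k)) 0 := by
      have : (fun k : ℕ => numCoeff ℂ (2 * k) * z ^ (2 * k)) = fun _ => 0 := by
        funext k
        simp [numCoeff]
      rw [this]
      exact hasSum_zero
    have h2 : HasSum (fun k : ℕ => numCoeff ℂ (2 * k + 1) * z ^ (2 * k + 1))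
        ((z * Complex.cosh z - Complex.sinh z) / z ^ 2) := by
      have hc : HasSum (fun k : ℕ => z * (z ^ (2 * k) / (((2 * k).factorial : ℕ) : ℂ)))
          (z * Complex.cosh z) := (Complex.hasSum_cosh z).mul_left z
      have h : HasSum (fun k : ℕ => (z * (z ^ (2 * k) / (((2 * k).factorial : ℕ) : ℂ))
          - z ^ (2 * k + 1) / (((2 * k + 1).factorial : ℕ) : ℂ)) / z ^ 2)
          ((z * Complex.cosh z - Complex.sinh z) / z ^ 2) :=
        (hc.sub (Complex.hasSum_sinh z)).div_const (z ^ 2)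
      have h' := (hasSum_nat_add_iff' 1).2 h
      have e : (fun k : ℕ => numCoeff ℂ (2 * k + 1) * z ^ (2 * k + 1))
          = fun k : ℕ => (z * (z ^ (2 * (k + 1)) / (((2 * (k + 1)).factorial : ℕ) : ℂ))
              - z ^ (2 * (k + 1) + 1) / (((2 * (k + 1) + 1).factorial : ℕ) : ℂ)) / z ^ 2 := by
        funext k
        have e1 : numCoeff ℂ (2 * k + 1)
            = ((2 * k + 2 : ℕ) : ℂ) / (((2 * (k + 1) + 1).factorial : ℕ) : ℂ) := by
          simp [numCoeff]
          ring_nf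
        have h0 : (((2 * (k + 1)).factorial : ℕ) : ℂ) ≠ 0 := by exact_mod_cast Nat.factorial_ne_zero _
        have h3 : (2 * (k : ℂ) + 3) ≠ 0 := by
          exact_mod_cast (Nat.succ_ne_zero (2 * k + 2))
        have h4 : (((2 * (k + 1) + 1).factorial : ℕ) : ℂ)
            = (2 * (k : ℂ) + 3) * (((2 * (k + 1)).factorial : ℕ) : ℂ) := by
          rw [Nat.factorial_succ]
          push_cast
          ring
        rw [e1, h4]
        generalize (((2 * (k + 1)).factorial : ℕ) : ℂ) = c at h0
        have h5 : z ^ (2 * (k + 1)) = z ^ (2 * k) * z ^ 2 := by ring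
        have h6 : z ^ (2 * (k + 1) + 1) = z ^ (2 * k) * z ^ 2 * z := by ring
        have h7 : z ^ (2 * k + 1) = z ^ (2 * k) * z := by ring
        rw [h5, h6, h7]
        generalize z ^ (2 * k) = w
        push_cast
        field_simp
        ring
      rw [e]
      simpa using h'
    have h3 := HasSum.even_add_odd (f := fun n => numCoeff ℂ n * z ^ n) h1 h2
    rwa [zero_add] at h3
  rw [hN.tsum_eq, hD.tsum_eq]
  field_simp

/-- `F(f)` for the meromorphic function `F(z) = coth z - 1 / z` (with `F(0) = 0`), as the quotient
of `(z * cosh z - sinh z) / z ^ 2` by `sinh z / z`, both entire. The denominator is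
invertible at `f` exactly when the spectrum of `f` does not meet the set `iπℤ*` of poles of `F`;
otherwise the value is meaningless. -/
def cothSubInv (f : End K V) : End K V :=
  powerSeriesEnd (numCoeff K) f * Ring.inverse (powerSeriesEnd (denCoeff K) f)

end FunctionalCalculus

/-! ### Smooth and analytic maps between finite-dimensional spaces -/

section Calculus

variable {K : Type*} [RCLike K] {V W : Type*}
  [AddCommGroup V] [Module K V] [FiniteDimensional K V] [AddCommGroup W] [Module K W]

/-- The canonical topology of a finite-dimensional vector space. -/
def IsOpenSet (U : Set V) : Prop := IsOpen[moduleTopology K V] U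

/-- `f` is smooth (for `K = ℂ`: holomorphic) on the open set `U`. Smoothness is expressed in linear
coordinates on the source and through linear functionals on the target. -/
def IsSmoothOn (f : V → W) (U : Set V) : Prop :=
  ∀ w : Dual K W, ContDiffOn K ∞
    (fun x : Fin (finrank K V) → K => w (f ((finBasis K V).equivFun.symm x)))
    ((finBasis K V).equivFun.symm ⁻¹' U)

/-- `f` is `K`-analytic on the open set `U`. -/
def IsAnalyticOn (f : V → W) (U : Set V) : Prop :=
  ∀ w : Dual K W, AnalyticOnNhd K
    (fun x : Fin (finrank K V) → K => w (f ((finBasis K V).equivFun.symm x)))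
    ((finBasis K V).equivFun.symm ⁻¹' U)

end Calculus

/-! ### Lie quasi-bialgebras and their doubles -/

section QuasiBialgebra

/-- The endomorphism `ad*_x` of `𝔤*`, the transpose of `ad_x` (without sign). -/
def adStar (K : Type*) [RCLike K] {g : Type*} [LieRing g] [LieAlgebra K g] (x : g) :
    End K (Dual K g) :=
  (LieAlgebra.ad K g x).dualMap

/-- The data `(ϖ, φ)` on a Lie algebra `𝔤` from which Lie quasi-bialgebras are made. The element `φ`
of `∧³𝔤` is given as the alternating form `ξ, η, ζ ↦ ⟨ξ ⊗ η ⊗ ζ, φ⟩` on `𝔤*`. -/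
structure Data (K g : Type*) [RCLike K] [LieRing g] [LieAlgebra K g] where
  /-- the cocycle `x ↦ ϖ_x`, with values in the linear maps from `𝔤*` to `𝔤` -/
  cocycle : g →ₗ[K] (Dual K g →ₗ[K] g)
  /-- the associator `φ` -/
  assoc : (Dual K g) [⋀^Fin 3]→ₗ[K] K

variable {K : Type*} [RCLike K] {g : Type*} [LieRing g] [LieAlgebra K g]

/-- Skew-symmetric linear maps from `𝔤*` to `𝔤`. -/
def IsSkew (t : Dual K g →ₗ[K] g) : Prop := ∀ ξ η : Dual K g, ξ (t η) = -η (t ξ)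

theorem alt_add_snd (f : (Dual K g) [⋀^Fin 3]→ₗ[K] K) (ξ η η' ζ : Dual K g) :
    f ![ξ, η + η', ζ] = f ![ξ, η, ζ] + f ![ξ, η', ζ] := by
  have e : ∀ x : Dual K g, Function.update ![ξ, 0, ζ] 1 x = ![ξ, x, ζ] := by
    intro x
    funext i
    fin_cases i <;> simp
  have h := f.map_update_add ![ξ, 0, ζ] 1 η η'
  rwa [e, e, e] at h

theorem alt_smul_snd (f : (Dual K g) [⋀^Fin 3]→ₗ[K] K) (c : K) (ξ η ζ : Dual K g) :
    f ![ξ, c • η, ζ] = c * f ![ξ, η, ζ] := by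
  have e : ∀ x : Dual K g, Function.update ![ξ, 0, ζ] 1 x = ![ξ, x, ζ] := by
    intro x
    funext i
    fin_cases i <;> simp
  have h := f.map_update_smul ![ξ, 0, ζ] 1 c η
  rwa [e, e] at h

theorem alt_add_trd (f : (Dual K g) [⋀^Fin 3]→ₗ[K] K) (ξ η ζ ζ' : Dual K g) :
    f ![ξ, η, ζ + ζ'] = f ![ξ, η, ζ] + f ![ξ, η, ζ'] := by
  have e : ∀ x : Dual K g, Function.update ![ξ, η, 0] 2 x = ![ξ, η, x] := by
    intro x
    funext i
    fin_cases i <;> simp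
  have h := f.map_update_add ![ξ, η, 0] 2 ζ ζ'
  rwa [e, e, e] at h

theorem alt_smul_trd (f : (Dual K g) [⋀^Fin 3]→ₗ[K] K) (c : K) (ξ η ζ : Dual K g) :
    f ![ξ, η, c • ζ] = c * f ![ξ, η, ζ] := by
  have e : ∀ x : Dual K g, Function.update ![ξ, η, 0] 2 x = ![ξ, η, x] := by
    intro x
    funext i
    fin_cases i <;> simp
  have h := f.map_update_smul ![ξ, η, 0] 2 c ζ
  rwa [e, e] at h

variable [FiniteDimensional K g]

/-- The element `⟨ξ ⊗ η ⊗ 1, φ⟩` of `𝔤`, where `f` is the alternating form of `φ`. -/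
def contract (f : (Dual K g) [⋀^Fin 3]→ₗ[K] K) (ξ η : Dual K g) : g :=
  (evalEquiv K g).symm
    { toFun := fun ζ => f ![ξ, η, ζ]
      map_add' := fun a b => alt_add_trd f ξ η a b
      map_smul' := fun c a => alt_smul_trd f c ξ η a }

theorem apply_contract (f : (Dual K g) [⋀^Fin 3]→ₗ[K] K) (ξ η ζ : Dual K g) :
    ζ (contract f ξ η) = f ![ξ, η, ζ] := by
  rw [contract, apply_evalEquiv_symm_apply]
  rfl

theorem eq_of_forall_dual {x y : g} (h : ∀ ζ : Dual K g, ζ x = ζ y) : x = y :=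
  (evalEquiv K g).injective (LinearMap.ext h)

namespace Data

/-- The bracket on `𝔡 = 𝔤 ⊕ 𝔤*`:
`[x, y] = [x, y]`, `[x, ξ] = ϖ_x ξ - ad*_x ξ`, `[ξ, η] = ⟨η, ϖ_• ξ⟩ + ⟨ξ ⊗ η ⊗ 1, φ⟩`. -/
def doubleBracket (G : Data K g) :
    (g × Dual K g) →ₗ[K] (g × Dual K g) →ₗ[K] (g × Dual K g) :=
  LinearMap.mk₂ K
    (fun X Y =>
      (⁅X.1, Y.1⁆ + G.cocycle X.1 Y.2 - G.cocycle Y.1 X.2 + contract G.assoc X.2 Y.2,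
        -adStar K X.1 Y.2 + adStar K Y.1 X.2 + Y.2 ∘ₗ G.cocycle.flip X.2))
    (by
      intro X X' Y
      refine Prod.ext (eq_of_forall_dual (K := K) fun ζ => ?_) (LinearMap.ext fun x => ?_)
      · have h := G.assoc.map_vecCons_add ![Y.2, ζ] X.2 X'.2
        simp [apply_contract, h]
        ring
      · simp [adStar]
        ring)
    (by
      intro c X Y
      refine Prod.ext (eq_of_forall_dual (K := K) fun ζ => ?_) (LinearMap.ext fun x => ?_)
      · have h := G.assoc.map_vecCons_smul ![Y.2, ζ] c X.2
        simp [apply_contract, h]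
        ring
      · simp [adStar])
    (by
      intro X Y Y'
      refine Prod.ext (eq_of_forall_dual (K := K) fun ζ => ?_) (LinearMap.ext fun x => ?_)
      · simp [apply_contract, alt_add_snd]
        ring
      · simp [adStar]
        ring)
    (by
      intro c X Y
      refine Prod.ext (eq_of_forall_dual (K := K) fun ζ => ?_) (LinearMap.ext fun x => ?_)
      · simp [apply_contract, alt_smul_snd]
        ring
      · simp [adStar])

/-- `(𝔤, [ , ], ϖ, φ)` is a Lie quasi-bialgebra: `ϖ` is a Lie algebra 1-cocycle with values in the
skew-symmetric maps, and `𝔡 = 𝔤 ⊕ 𝔤*` with the bracket above is a Lie algebra. -/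
structure IsLieQuasiBialgebra (G : Data K g) : Prop where
  skew : ∀ x, IsSkew (G.cocycle x)
  cocycle_lie : ∀ (x y : g) (ξ : Dual K g),
    G.cocycle ⁅x, y⁆ ξ = ⁅x, G.cocycle y ξ⁆ + G.cocycle y (adStar K x ξ)
      - ⁅y, G.cocycle x ξ⁆ - G.cocycle x (adStar K y ξ)
  bracket_self : ∀ X, G.doubleBracket X X = 0
  jacobi : ∀ X Y Z,
    G.doubleBracket X (G.doubleBracket Y Z) + G.doubleBracket Y (G.doubleBracket Z X)
      + G.doubleBracket Z (G.doubleBracket X Y) = 0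

/-- The adjoint action `Ad_{exp X} = exp (ad_X)` on the double `𝔡` of the exponential of `X ∈ 𝔡`. -/
def adExp (G : Data K g) (X : g × Dual K g) : End K (g × Dual K g) :=
  expEnd (G.doubleBracket X)

/-- The Alekseev-Meinrenken map of a cocommutative Lie quasi-bialgebra `(𝔤, [ , ], 0, φ)`,
`p ↦ F(ad_p) : 𝔤* → 𝔤` with `F(z) = coth z - 1 / z` and `ad_p` the adjoint action on the
double. (`F` is odd, so `F(ad_p)` maps `𝔤*` into `𝔤`, and taking the `𝔤`-component loses nothing.) -/
def rAM (G : Data K g) (p : Dual K g) : Dual K g →ₗ[K] g :=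
  LinearMap.fst K g (Dual K g) ∘ₗ cothSubInv (G.doubleBracket (0, p)) ∘ₗ
    LinearMap.inr K g (Dual K g)

end Data

end QuasiBialgebra

/-! ### Dynamical ℓ-matrices -/

section Dynamical

variable {K : Type*} [RCLike K] {g : Type*} [LieRing g] [LieAlgebra K g]

/-- The restriction map `i* : 𝔤* → 𝔩*`, the transpose of the inclusion. -/
def restrict (l : LieSubalgebra K g) : Dual K g →ₗ[K] Dual K l :=
  l.toSubmodule.subtype.dualMap

/-- Sum over the cyclic permutations of three arguments. -/
def cyclicSum {A : Type*} (f : A → A → A → K) (a b c : A) : K := f a b c + f b c a + f c a b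

variable [FiniteDimensional K g]

/-- `U ⊆ 𝔩*` is invariant under the coadjoint action of the connected Lie group `L` of `𝔩`, which is
generated by exponentials, and `Ad*_{exp z} = exp (ad*_z)`. -/
def IsCoadjointInvariant (l : LieSubalgebra K g) (U : Set (Dual K l)) : Prop :=
  ∀ (z : l), ∀ p ∈ U, expEnd (adStar K z) p ∈ U

/-- `r` is a dynamical ℓ-matrix on the open set `U ⊆ 𝔩*` associated with `(𝔤, [ , ], ϖ, φ)`: a smooth
map with skew-symmetric values that satisfies the generalized classical dynamical Yang-Baxter
equation and is `𝔩`-equivariant. Here `⟨ζ, d_p r(β) η⟩` is the derivative of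
`q ↦ ⟨ζ, r_q η⟩` at `p` in the direction `β`. -/
structure IsDynamicalLMatrix (G : Data K g) (l : LieSubalgebra K g) (U : Set (Dual K l))
    (r : Dual K l → (Dual K g →ₗ[K] g)) : Prop where
  isOpen : IsOpenSet (K := K) U
  invariant : IsCoadjointInvariant l U
  skew : ∀ p ∈ U, IsSkew (r p)
  smooth : IsSmoothOn (K := K) r U
  yangBaxter : ∀ p ∈ U, ∀ ξ η ζ : Dual K g,
    cyclicSum (fun ξ η ζ : Dual K g =>
      lineDeriv K (fun q => ζ (r q η)) p (restrict l ξ)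
        - ζ ⁅r p ξ, r p η⁆ - ζ (G.cocycle (r p ξ) η)) ξ η ζ
      = G.assoc ![ξ, η, ζ]
  equivariant : ∀ p ∈ U, ∀ (z : l) (ξ ζ : Dual K g),
    lineDeriv K (fun q => ζ (r q ξ)) p (adStar K z p)
      + ζ (G.cocycle (z : g) ξ) + ζ ⁅(z : g), r p ξ⁆ + ζ (r p (adStar K (z : g) ξ)) = 0

end Dynamical

/-! ### Reductive decompositions and the canonical ℓ-matrix -/

section Reductive

/-- A reductive decomposition `𝔤 = 𝔩 ⊕ 𝔪`: `𝔩` is a Lie subalgebra and `[𝔩, 𝔪] ⊆ 𝔪`. -/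
structure ReductiveDecomposition (K g : Type*) [RCLike K] [LieRing g] [LieAlgebra K g] where
  l : LieSubalgebra K g
  m : Submodule K g
  isCompl : IsCompl l.toSubmodule m
  lie_mem : ∀ x ∈ l, ∀ y ∈ m, ⁅x, y⁆ ∈ m

variable {K : Type*} [RCLike K] {g : Type*} [LieRing g] [LieAlgebra K g]

namespace ReductiveDecomposition

/-- The projection of `𝔤` onto `𝔩` along `𝔪`. -/
def proj (R : ReductiveDecomposition K g) : g →ₗ[K] R.l :=
  R.l.toSubmodule.projectionOnto R.m R.isCompl

/-- `s : 𝔩* → 𝔤*`, the transpose of the projection. -/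
def s (R : ReductiveDecomposition K g) : Dual K R.l →ₗ[K] Dual K g := R.proj.dualMap

/-- The annihilator `𝔩^⊥ ⊆ 𝔤*`. -/
def lPerp (R : ReductiveDecomposition K g) : Submodule K (Dual K g) :=
  R.l.toSubmodule.dualAnnihilator

/-- The annihilator `𝔪^⊥ ⊆ 𝔤*`. -/
def mPerp (R : ReductiveDecomposition K g) : Submodule K (Dual K g) := R.m.dualAnnihilator

end ReductiveDecomposition

/-- A map `r` on `U` with values in the linear maps from `𝔤*` to `𝔤` is compatible with `𝔤 = 𝔩 ⊕ 𝔪`: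
`r_p 𝔪^⊥ ⊆ 𝔩` and `r_p 𝔩^⊥ ⊆ 𝔪` for all `p ∈ U`. -/
def IsCompatibleOn (R : ReductiveDecomposition K g) (U : Set (Dual K R.l))
    (r : Dual K R.l → (Dual K g →ₗ[K] g)) : Prop :=
  ∀ p ∈ U, (∀ ξ ∈ R.mPerp, r p ξ ∈ R.l) ∧ (∀ ξ ∈ R.lPerp, r p ξ ∈ R.m)

namespace Data

/-- Compatibility of `(𝔤, [ , ], ϖ, φ)` with `𝔤 = 𝔩 ⊕ 𝔪`. As an element of
`∧³𝔤 = ∧³𝔩 ⊕ (∧²𝔩 ⊗ 𝔪) ⊕ (𝔩 ⊗ ∧²𝔪) ⊕ ∧³𝔪`, `φ` lies in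
`Alt(𝔩⊗𝔩⊗𝔩 ⊕ 𝔩⊗𝔪⊗𝔪 ⊕ 𝔪⊗𝔪⊗𝔪)` when its component in `∧²𝔩 ⊗ 𝔪` vanishes. -/
structure IsCompatible (G : Data K g) (R : ReductiveDecomposition K g) : Prop where
  cocycle_l : ∀ x ∈ R.l, G.cocycle x = 0
  cocycle_mPerp : ∀ x, ∀ ξ ∈ R.mPerp, ∀ η ∈ R.mPerp, ξ (G.cocycle x η) = 0
  assoc_llm : ∀ ξ ∈ R.mPerp, ∀ η ∈ R.mPerp, ∀ ζ ∈ R.lPerp, G.assoc ![ξ, η, ζ] = 0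

/-- Canonical compatibility: moreover `φ ≡ 0 mod 𝔩`, that is `φ` has image `0` in `∧³(𝔤/𝔩)`. -/
structure IsCanonicallyCompatible (G : Data K g) (R : ReductiveDecomposition K g) : Prop
    extends G.IsCompatible R where
  assoc_mod_l : ∀ ξ ∈ R.lPerp, ∀ η ∈ R.lPerp, ∀ ζ ∈ R.lPerp, G.assoc ![ξ, η, ζ] = 0

/-- The quadruple `(𝔩, [ , ], 0, p_𝔩^{(3)} φ)`. -/
def onL (G : Data K g) (R : ReductiveDecomposition K g) : Data K R.l where
  cocycle := 0
  assoc := G.assoc.compLinearMap R.s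

variable [FiniteDimensional K g]

/-- The endomorphism `p_𝔤 Ad_{exp (-s p)} i_𝔤` of `𝔤`. -/
def adBlock (G : Data K g) (R : ReductiveDecomposition K g) (p : Dual K R.l) : End K g :=
  LinearMap.fst K g (Dual K g) ∘ₗ G.adExp (0, -R.s p) ∘ₗ LinearMap.inl K g (Dual K g)

/-- The set `U` of those `p ∈ 𝔩*` such that the spectrum of `ad_p` on the double `𝔩 ⊕ 𝔩*` of
`(𝔩, [ , ], 0, p_𝔩^{(3)} φ)` does not meet `iπℤ*` and `0` is not in the spectrum of
`p_𝔤 Ad_{exp (-s p)} i_𝔤`. -/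
def domain (G : Data K g) (R : ReductiveDecomposition K g) : Set (Dual K R.l) :=
  {p | complexSpectrum ((G.onL R).doubleBracket (0, p)) ∩ nonzeroMultiplesOfIPi = ∅ ∧
    (0 : ℂ) ∉ complexSpectrum (G.adBlock R p)}

/-- The canonical ℓ-matrix: on `ζ = s α + ξ`, with `α = i* ζ ∈ 𝔩*` and `ξ = ζ - s (i* ζ) ∈ 𝔩^⊥`, it is
`rAM_p α - (p_𝔤 Ad_{exp (-s p)} i_𝔤)⁻¹ p_𝔤 Ad_{exp (-s p)} ξ`. -/
def lcan (G : Data K g) (R : ReductiveDecomposition K g) (p : Dual K R.l) :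
    Dual K g →ₗ[K] g :=
  R.l.toSubmodule.subtype ∘ₗ (G.onL R).rAM p ∘ₗ restrict R.l
    - Ring.inverse (G.adBlock R p) ∘ₗ LinearMap.fst K g (Dual K g) ∘ₗ
        G.adExp (0, -R.s p) ∘ₗ LinearMap.inr K g (Dual K g) ∘ₗ
        (LinearMap.id - R.s ∘ₗ restrict R.l)

theorem lcan_apply (G : Data K g) (R : ReductiveDecomposition K g) (p α : Dual K R.l)
    (ξ : Dual K g) (hξ : ξ ∈ R.lPerp) :
    G.lcan R p (R.s α + ξ) =
      ((G.onL R).rAM p α : g) - Ring.inverse (G.adBlock R p) (G.adExp (0, -R.s p) (0, ξ)).1 := by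
  have h1 : restrict R.l ξ = 0 := by
    ext x
    exact (Submodule.mem_dualAnnihilator ξ).1 hξ x x.2
  have h2 : restrict R.l (R.s α) = α := by
    ext x
    exact congrArg α (Submodule.projectionOnto_apply_left R.isCompl x)
  simp [lcan, h1, h2]

end Data

end Reductive

end LieQuasi

end

/-!
Write `Q = ad_{-s p}` in the double `𝔡`, which is a Lie algebra with the invariant form
`⟨x + ξ, y + η⟩ = ξ y + η x`, and let `Γ = {l_p ξ + ξ}` be the graph of the canonical ℓ-matrix. The
form vanishes on `Γ`, because `l_p` is skew, and the dynamical Yang-Baxter equation says that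
`⟨[X, Y], Z⟩`, for `X, Y, Z ∈ Γ` lying over `ξ, η, ζ`, is the cyclic sum of the derivatives of `l`
(`form_graph`).

By compatibility, `𝔩 ⊕ s 𝔩*` is a subalgebra of `𝔡`, isomorphic to the double of
`(𝔩, [ , ], 0, p_𝔩^{(3)} φ)`, and its orthogonal complement `𝔪 ⊕ 𝔩^⊥` is stable under it
(`doubleBracket_embed`, `doubleBracket_embed_mem`). The graph splits accordingly: over `s 𝔩*` it is
the graph of the Alekseev-Meinrenken r-matrix, and over `𝔩^⊥` it is `exp (-Q) 𝔩^⊥`, which is what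
the formula for `l` says (`adExp_lcan`). So the equation has four components.

* Over `s 𝔩*` three times, it is the equation for the Alekseev-Meinrenken r-matrix
  (`IsQuadraticLie.alekseevMeinrenken`).
* Over `s 𝔩*` twice and `𝔩^⊥` once, both sides vanish by orthogonality.
* Over `s 𝔩*` once and `𝔩^⊥` twice, differentiating `(exp Q (l_p ξ + ξ))_𝔤 = 0` in the direction `α`
  produces `((exp Q - 1) / Q) s α` where the equation has `exp Q (l_p s α + s α)`. The difference of
  the two is an odd function of `ad_p` applied to `α`, so it lies in `𝔩`, where `ϖ` vanishes
  (`exists_dexp_sub_adExp`, `deriv_lcan_lPerp`).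
* Over `𝔩^⊥` three times, the automorphism `exp Q` turns the equation into the vanishing of `φ` on
  `𝔩^⊥`.

The calculus of functions of `ad_p` is reduced to identities between powers. Derivatives of entire
functions of an endomorphism are operator divided differences (`hasWDerivAt_evalSeries`). For a
trilinear form invariant under `P`, applying `P` in each of the three slots defines commuting
operators `a, b, c` on forms with `a + b + c = 0` (`exists_slotAlgebra`), so that the equation for
the Alekseev-Meinrenken r-matrix becomes an identity of entire functions in a commutative
finite-dimensional algebra (`divDiff_num_den_identity`). Multiplied by `a b c`, it expresses
the addition theorem of `sinh`, and the factor is cancelled by a perturbation argument.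

Equivariance holds because the derivative of a function of `ad_p` along the coadjoint orbit of `p`
is a commutator (`divDiff_commutator`). Openness of the domain and analyticity follow once the two
spectral conditions are read as invertibility of `sinh (ad_p) / ad_p` and of `p_𝔤 exp Q i_𝔤`
(`mem_domain_iff`); the coadjoint action conjugates both by automorphisms.
-/

set_option maxSynthPendingDepth 3

noncomputable section

namespace LieQuasi

/-! ### Entire functional calculus in finite-dimensional algebras -/

section Series

variable {K : Type*} [RCLike K]

/-- The power series with coefficients `a` has infinite radius of convergence. -/
def IsEntire (a : ℕ → K) : Prop := ∀ r : ℝ, Summable fun n => ‖a n‖ * r ^ n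

/-- The element `∑ₙ aₙ xⁿ` of a finite-dimensional algebra, summed in the canonical topology. For
an algebra of endomorphisms this is `powerSeriesEnd`; the other algebras that occur are commutative
ones and matrix algebras. -/
def evalSeries {A : Type*} [Ring A] [Algebra K A] (a : ℕ → K) (x : A) : A :=
  letI : TopologicalSpace A := moduleTopology K A
  ∑' n : ℕ, a n • x ^ n

open scoped Matrix.Norms.Operator in
/-- A finite-dimensional algebra carries a compatible norm, obtained by embedding it into a matrix
algebra. The equalities allow the norm to be introduced without changing the algebra structure. -/
theorem exists_normedAlgebra (K A : Type*) [RCLike K] [Ring A] [Algebra K A]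
    [FiniteDimensional K A] :
    ∃ (i : NormedRing A) (j : NormedAlgebra K A), i.toRing = ‹Ring A› ∧
      HEq j.toAlgebra ‹Algebra K A› := by
  let φ := Algebra.leftMulMatrix (finBasis K A)
  let i : NormedRing A := NormedRing.induced A _ φ (Algebra.leftMulMatrix_injective _)
  exact ⟨i, NormedAlgebra.induced K A _ φ, rfl, HEq.rfl⟩

section Normed

variable {A : Type*} [NormedRing A] [NormedAlgebra K A] [FiniteDimensional K A]

theorem evalSeries_eq_tsum (a : ℕ → K) (x : A) : evalSeries a x = ∑' n : ℕ, a n • x ^ n := by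
  have : IsModuleTopology K A := isModuleTopologyOfFiniteDimensional
  unfold evalSeries
  congr 1
  exact (eq_moduleTopology K A).symm

theorem IsEntire.summable_smul_pow {a : ℕ → K} (ha : IsEntire a) (x : A) :
    Summable fun n => a n • x ^ n := by
  have : CompleteSpace A := FiniteDimensional.complete K A
  refine (summable_nat_add_iff 1).1
    (.of_norm_bounded ((summable_nat_add_iff 1).2 (ha ‖x‖)) fun n => ?_)
  rw [norm_smul]
  gcongr
  exact norm_pow_le' x n.succ_pos

theorem IsEntire.analyticAt_evalSeries {a : ℕ → K} (ha : IsEntire a) (x : A) :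
    AnalyticAt K (fun y : A => evalSeries a y) x := by
  have : CompleteSpace A := FiniteDimensional.complete K A
  have hr : (FormalMultilinearSeries.ofScalars A a).radius = ⊤ := by
    refine FormalMultilinearSeries.radius_eq_top_of_summable_norm _ fun r => ?_
    refine (summable_nat_add_iff 1).1
      (.of_norm_bounded ((summable_nat_add_iff 1).2 (ha r)) fun n => ?_)
    rw [norm_mul, norm_norm, norm_pow, NNReal.norm_eq]
    gcongr
    exact FormalMultilinearSeries.ofScalars_norm_le A a _ n.succ_pos
  have h := (FormalMultilinearSeries.ofScalars A a).hasFPowerSeriesOnBall (by rw [hr]; simp)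
  have h2 : (fun y : A => evalSeries a y) = (FormalMultilinearSeries.ofScalars A a).sum := by
    funext y
    rw [evalSeries_eq_tsum]
    exact (FormalMultilinearSeries.ofScalars_sum_eq a y).symm
  rw [h2]
  exact h.analyticAt_of_mem (by simp [hr])

end Normed

variable {A B : Type*} [Ring A] [Algebra K A] [FiniteDimensional K A] [Ring B] [Algebra K B]
  [FiniteDimensional K B] {W : Type*} [AddCommGroup W] [Module K W]

/-- The functional calculus is determined by linear functionals; this is the only form in which
convergence is used. -/
theorem IsEntire.hasSum {a : ℕ → K} (ha : IsEntire a) (x : A) (w : Dual K A) :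
    HasSum (fun n => a n * w (x ^ n)) (w (evalSeries a x)) := by
  -- The given algebra structure is replaced by the one underlying a norm.
  rename_i r al _
  obtain ⟨i, j, rfl, h⟩ := exists_normedAlgebra K A
  obtain rfl := eq_of_heq h
  have h1 := (ha.summable_smul_pow x).hasSum
  rw [← evalSeries_eq_tsum] at h1
  simpa using h1.mapL (LinearMap.toContinuousLinearMap w)

theorem eq_of_forall_dual_apply {x y : W} (h : ∀ w : Dual K W, w x = w y) : x = y := by
  rw [← sub_eq_zero]
  exact (forall_dual_apply_eq_zero_iff K _).1 fun w => by rw [map_sub, h, sub_self]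

/-- Two elements whose powers agree under linear maps have the same entire functions under these
maps. Almost every algebraic property of the functional calculus is an instance of this. -/
theorem IsEntire.map_evalSeries_eq {a : ℕ → K} (ha : IsEntire a) {x : A} {y : B} (Φ : A →ₗ[K] W)
    (Ψ : B →ₗ[K] W) (h : ∀ n, Φ (x ^ n) = Ψ (y ^ n)) :
    Φ (evalSeries a x) = Ψ (evalSeries a y) := by
  refine eq_of_forall_dual_apply (K := K) fun w => ?_
  have h1 := ha.hasSum x (w ∘ₗ Φ)
  have h2 := ha.hasSum y (w ∘ₗ Ψ)
  simp only [LinearMap.comp_apply, h] at h1 h2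
  exact h1.unique h2

/-- The functional calculus commutes with algebra homomorphisms. -/
theorem IsEntire.algHom_evalSeries {a : ℕ → K} (ha : IsEntire a) (φ : A →ₐ[K] B) (x : A) :
    φ (evalSeries a x) = evalSeries a (φ x) :=
  ha.map_evalSeries_eq φ.toLinearMap LinearMap.id fun n => by simp

theorem IsEntire.commute_evalSeries {a : ℕ → K} (ha : IsEntire a) {x y : A} (h : Commute y x) :
    Commute y (evalSeries a x) :=
  ha.map_evalSeries_eq (LinearMap.mulLeft K y) (LinearMap.mulRight K y) fun n => h.pow_right n

/-- An intertwiner of two endomorphisms intertwines their entire functions. -/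
theorem IsEntire.intertwine {a : ℕ → K} (ha : IsEntire a) {V V' : Type*} [AddCommGroup V]
    [Module K V] [FiniteDimensional K V] [AddCommGroup V'] [Module K V'] [FiniteDimensional K V']
    {f : End K V} {f' : End K V'} (φ : V →ₗ[K] V') (h : ∀ v, φ (f v) = f' (φ v)) (v : V) :
    φ (evalSeries a f v) = evalSeries a f' (φ v) := by
  refine ha.map_evalSeries_eq (φ ∘ₗ LinearMap.applyₗ v) (LinearMap.applyₗ (φ v)) fun n => ?_
  change φ ((f ^ n) v) = (f' ^ n) (φ v)
  induction n generalizing v with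
  | zero => simp
  | succ n ih => rw [pow_succ, pow_succ, Module.End.mul_apply, Module.End.mul_apply, ih, h]

/-- If `f` preserves a subspace, so do its entire functions. -/
theorem IsEntire.evalSeries_mem {a : ℕ → K} (ha : IsEntire a) {V : Type*} [AddCommGroup V]
    [Module K V] [FiniteDimensional K V] {f : End K V} {S : Submodule K V}
    (h : ∀ v ∈ S, f v ∈ S) {v : V} (hv : v ∈ S) : evalSeries a f v ∈ S := by
  have h1 := ha.intertwine (f := f.restrict h) (f' := f) S.subtype (fun v => rfl) ⟨v, hv⟩
  rw [Submodule.subtype_apply, Submodule.subtype_apply] at h1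
  rw [← h1]
  exact Subtype.mem _

/-- Shifting the coefficients of a power series amounts to multiplying by the variable. -/
theorem IsEntire.evalSeries_shift {a b : ℕ → K} (ha : IsEntire a) (hb : IsEntire b)
    (h : ∀ n, b (n + 1) = a n) (x : A) :
    evalSeries b x = algebraMap K A (b 0) + x * evalSeries a x := by
  refine eq_of_forall_dual_apply (K := K) fun w => ?_
  refine (hb.hasSum x w).unique ?_
  rw [← hasSum_nat_add_iff' 1]
  have := ha.hasSum x (w ∘ₗ LinearMap.mulLeft K x)
  simpa [h, Algebra.algebraMap_eq_smul_one, pow_succ'] using this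

theorem IsEntire.evalSeries_neg {a b : ℕ → K} (ha : IsEntire a) (hb : IsEntire b)
    (h : ∀ n, a n * (-1) ^ n = b n) (x : A) : evalSeries a (-x) = evalSeries b x := by
  refine eq_of_forall_dual_apply (K := K) fun w => ?_
  refine (ha.hasSum (-x) w).unique ?_
  convert hb.hasSum x w using 2 with n
  rw [← h, ← neg_one_smul K x, smul_pow, map_smul, smul_eq_mul, mul_assoc]

theorem evalSeries_zero {a : ℕ → K} (ha : IsEntire a) :
    evalSeries a (0 : A) = algebraMap K A (a 0) := by
  refine eq_of_forall_dual_apply (K := K) fun w => (ha.hasSum 0 w).unique ?_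
  convert hasSum_single (f := fun n => a n * w ((0 : A) ^ n)) 0 fun n hn => ?_ using 1
  · simp [Algebra.algebraMap_eq_smul_one]
  · simp [hn]

end Series

/-! ### Weak analyticity and weak derivatives -/

section Weak

variable {K : Type*} [RCLike K] {E : Type*} [NormedAddCommGroup E] [NormedSpace K E]
  {W W₁ W₂ : Type*} [AddCommGroup W] [Module K W] [AddCommGroup W₁] [Module K W₁]
  [AddCommGroup W₂] [Module K W₂]

/-- Analyticity at a point of a map into a vector space without a chosen norm, tested by linear
functionals. -/
def WAnalyticAt (K : Type*) [RCLike K] {E : Type*} [NormedAddCommGroup E] [NormedSpace K E]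
    {W : Type*} [AddCommGroup W] [Module K W] (f : E → W) (x : E) : Prop :=
  ∀ w : Dual K W, AnalyticAt K (fun y => w (f y)) x

/-- Differentiability of a curve in a vector space without a chosen norm, tested by linear
functionals. -/
def HasWDerivAt (c : K → W) (c' : W) (t : K) : Prop :=
  ∀ w : Dual K W, HasDerivAt (fun s => w (c s)) (w c') t

theorem WAnalyticAt.const (w : W) (x : E) : WAnalyticAt K (fun _ : E => w) x :=
  fun _ => analyticAt_const

theorem WAnalyticAt.linear {f : E → W} {x : E} (hf : WAnalyticAt K f x) (L : W →ₗ[K] W₁) :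
    WAnalyticAt K (fun y => L (f y)) x :=
  fun w => hf (w ∘ₗ L)

theorem WAnalyticAt.add {f h : E → W} {x : E} (hf : WAnalyticAt K f x) (hh : WAnalyticAt K h x) :
    WAnalyticAt K (fun y => f y + h y) x := fun w => by
  simpa using (hf w).fun_add (hh w)

theorem WAnalyticAt.sub {f h : E → W} {x : E} (hf : WAnalyticAt K f x) (hh : WAnalyticAt K h x) :
    WAnalyticAt K (fun y => f y - h y) x := fun w => by
  simpa using (hf w).fun_sub (hh w)

theorem apply_eq_sum_coord [FiniteDimensional K W] (w : Dual K W) (u : W) :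
    w u = ∑ i, (finBasis K W).coord i u * w (finBasis K W i) := by
  conv_lhs => rw [← (finBasis K W).sum_repr u]
  simp only [map_sum, map_smul, smul_eq_mul, Basis.coord_apply]

theorem apply_bilinear_eq_sum [FiniteDimensional K W₁] (β : W₁ →ₗ[K] W₂ →ₗ[K] W) (w : Dual K W)
    (u : W₁) (v : W₂) :
    w (β u v) = ∑ i, (finBasis K W₁).coord i u * (w ∘ₗ β (finBasis K W₁ i)) v := by
  exact apply_eq_sum_coord (w ∘ₗ β.flip v) u

theorem WAnalyticAt.bilinear [FiniteDimensional K W₁] {f : E → W₁} {h : E → W₂} {x : E}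
    (hf : WAnalyticAt K f x) (hh : WAnalyticAt K h x) (β : W₁ →ₗ[K] W₂ →ₗ[K] W) :
    WAnalyticAt K (fun y => β (f y) (h y)) x := fun w => by
  simp only [apply_bilinear_eq_sum]
  exact Finset.analyticAt_fun_sum _ fun i _ => (hf _).mul (hh _)

theorem WAnalyticAt.analyticAt {V : Type*} [NormedAddCommGroup V] [NormedSpace K V]
    [FiniteDimensional K V] {f : E → V} {x : E} (hf : WAnalyticAt K f x) : AnalyticAt K f x := by
  have h : f = fun y => ∑ i, (finBasis K V).coord i (f y) • finBasis K V i := by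
    funext y
    exact ((finBasis K V).sum_repr (f y)).symm
  rw [h]
  exact Finset.analyticAt_fun_sum _ fun i _ => (hf _).smul analyticAt_const

theorem AnalyticAt.wAnalyticAt {V : Type*} [NormedAddCommGroup V] [NormedSpace K V]
    [FiniteDimensional K V] {f : E → V} {x : E} (hf : AnalyticAt K f x) : WAnalyticAt K f x :=
  fun w => ((LinearMap.toContinuousLinearMap w).analyticAt _).comp hf

theorem WAnalyticAt.continuousAt {f : E → W} {x : E} (hf : WAnalyticAt K f x) (w : Dual K W) :
    ContinuousAt (fun y => w (f y)) x := (hf w).continuousAt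

section Algebra

variable {A : Type*} [Ring A] [Algebra K A] [FiniteDimensional K A] {f : E → A} {x : E}

theorem WAnalyticAt.mul {h : E → A} (hf : WAnalyticAt K f x) (hh : WAnalyticAt K h x) :
    WAnalyticAt K (fun y => f y * h y) x :=
  hf.bilinear hh (LinearMap.mul K A)

theorem WAnalyticAt.evalSeries {a : ℕ → K} (hf : WAnalyticAt K f x) (ha : IsEntire a) :
    WAnalyticAt K (fun y => evalSeries a (f y)) x := by
  rename_i r al _
  obtain ⟨i, j, rfl, h⟩ := exists_normedAlgebra K A
  obtain rfl := eq_of_heq h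
  exact AnalyticAt.wAnalyticAt ((ha.analyticAt_evalSeries (f x)).comp hf.analyticAt)

theorem WAnalyticAt.ringInverse (hf : WAnalyticAt K f x) (hx : IsUnit (f x)) :
    WAnalyticAt K (fun y => Ring.inverse (f y)) x := by
  rename_i r al _
  obtain ⟨i, j, rfl, h⟩ := exists_normedAlgebra K A
  obtain rfl := eq_of_heq h
  have : CompleteSpace A := FiniteDimensional.complete K A
  obtain ⟨u, hu⟩ := hx
  have h1 := analyticAt_inverse (𝕜 := K) u
  rw [hu] at h1
  exact AnalyticAt.wAnalyticAt (h1.comp hf.analyticAt)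

theorem isOpen_setOf_isUnit (hf : ∀ x, WAnalyticAt K f x) : IsOpen {x | IsUnit (f x)} := by
  rename_i r al _
  obtain ⟨i, j, rfl, h⟩ := exists_normedAlgebra K A
  obtain rfl := eq_of_heq h
  have : CompleteSpace A := FiniteDimensional.complete K A
  have hc : Continuous f := continuous_iff_continuousAt.2 fun x => (hf x).analyticAt.continuousAt
  exact Units.isOpen.preimage hc

end Algebra

theorem WAnalyticAt.exists_hasWDerivAt [FiniteDimensional K W] {c : K → W} {t : K}
    (hc : WAnalyticAt K c t) : ∃ c', HasWDerivAt c c' t := by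
  let b := finBasis K W
  refine ⟨∑ i, deriv (fun s => b.coord i (c s)) t • b i, fun w => ?_⟩
  have h : (fun s => w (c s)) = fun s => ∑ i, b.coord i (c s) * w (b i) := by
    funext s
    rw [apply_eq_sum_coord w (c s)]
  rw [h]
  simp only [map_sum, map_smul, smul_eq_mul]
  exact HasDerivAt.fun_sum fun i _ => ((hc (b.coord i)).differentiableAt.hasDerivAt).mul_const _

theorem HasWDerivAt.unique {c : K → W} {c₁ c₂ : W} {t : K} (h₁ : HasWDerivAt c c₁ t)
    (h₂ : HasWDerivAt c c₂ t) : c₁ = c₂ :=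
  eq_of_forall_dual_apply (K := K) fun w => (h₁ w).unique (h₂ w)

theorem HasWDerivAt.const (w : W) (t : K) : HasWDerivAt (fun _ : K => w) 0 t := fun v => by
  simpa using hasDerivAt_const t (v w)

theorem HasWDerivAt.linear {c : K → W} {c' : W} {t : K} (h : HasWDerivAt c c' t)
    (L : W →ₗ[K] W₁) : HasWDerivAt (fun s => L (c s)) (L c') t :=
  fun w => h (w ∘ₗ L)

theorem HasWDerivAt.add {c d : K → W} {c' d' : W} {t : K} (hc : HasWDerivAt c c' t)
    (hd : HasWDerivAt d d' t) : HasWDerivAt (fun s => c s + d s) (c' + d') t := fun w => by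
  simpa using (hc w).fun_add (hd w)

theorem HasWDerivAt.bilinear [FiniteDimensional K W₁] {c : K → W₁} {d : K → W₂} {c' : W₁} {d' : W₂}
    {t : K} (hc : HasWDerivAt c c' t) (hd : HasWDerivAt d d' t) (β : W₁ →ₗ[K] W₂ →ₗ[K] W) :
    HasWDerivAt (fun s => β (c s) (d s)) (β c' (d t) + β (c t) d') t := fun w => by
  simp only [map_add, apply_bilinear_eq_sum, ← Finset.sum_add_distrib]
  exact HasDerivAt.fun_sum fun i _ => (hc _).mul (hd _)

end Weak

/-! ### Divided differences -/

section DividedDifference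

variable {K : Type*} [RCLike K] {A : Type*} [Ring A] [Algebra K A] [FiniteDimensional K A]

/-- The operator divided difference `∑ₙ aₙ ∑_{i+j=n-1} xⁱ h yʲ`, read off as the corner entry of
the series evaluated at a triangular block matrix. -/
def divDiff (a : ℕ → K) (x h y : A) : A := evalSeries a !![x, h; 0, y] 0 1

theorem block_pow (x h y : A) (n : ℕ) :
    !![x, h; 0, y] ^ n =
      !![x ^ n, ∑ i ∈ Finset.range n, x ^ i * h * y ^ (n - 1 - i); 0, y ^ n] := by
  induction n with
  | zero => simp [Matrix.one_fin_two]
  | succ n ih =>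
    rw [pow_succ', ih, Matrix.mul_fin_two, Finset.sum_range_succ']
    simp [pow_succ', mul_assoc, Finset.mul_sum, Nat.sub_sub, add_comm]

theorem map_divDiff_eq {a : ℕ → K} (ha : IsEntire a) {B : Type*} [Ring B] [Algebra K B]
    [FiniteDimensional K B] {W : Type*} [AddCommGroup W] [Module K W] {x h y : A} {x' h' y' : B}
    (Φ : A →ₗ[K] W) (Ψ : B →ₗ[K] W)
    (H : ∀ i j, Φ (x ^ i * h * y ^ j) = Ψ (x' ^ i * h' * y' ^ j)) :
    Φ (divDiff a x h y) = Ψ (divDiff a x' h' y') := by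
  refine ha.map_evalSeries_eq (Φ ∘ₗ Matrix.entryLinearMap K A (0 : Fin 2) (1 : Fin 2))
    (Ψ ∘ₗ Matrix.entryLinearMap K B (0 : Fin 2) (1 : Fin 2)) fun n => ?_
  simp [block_pow, map_sum, H]

/-- The derivative of an entire function along a line is a divided difference. -/
theorem hasWDerivAt_evalSeries {a : ℕ → K} (ha : IsEntire a) (x h : A) :
    HasWDerivAt (fun t : K => evalSeries a (x + t • h)) (divDiff a x h x) 0 := by
  -- `!![x, h; 0, x + t h]` maps the column `(1, t)` to `(1, t) (x + t h)`, so the difference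
  -- quotient is the divided difference at `x, x + t h`.
  have key : ∀ t : K,
      evalSeries a (x + t • h) = evalSeries a x + t • divDiff a x h (x + t • h) := by
    intro t
    refine (ha.map_evalSeries_eq (x := !![x, h; 0, x + t • h])
      (Matrix.entryLinearMap K A 0 0 + t • Matrix.entryLinearMap K A 0 1) LinearMap.id
      (y := x + t • h) fun n => ?_).symm.trans ?_
    · induction n with
      | zero => simp
      | succ n ih =>
        simp only [LinearMap.add_apply, LinearMap.smul_apply, Matrix.entryLinearMap_apply,
          LinearMap.id_apply] at ih ⊢
        rw [pow_succ, pow_succ, ← ih, Matrix.mul_apply, Matrix.mul_apply]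
        simp [Fin.sum_univ_two, mul_add, add_mul]
        abel
    · have h0 := ha.map_evalSeries_eq (x := !![x, h; 0, x + t • h])
        (Matrix.entryLinearMap K A 0 0) LinearMap.id (y := x) fun n => by simp [block_pow]
      simp only [LinearMap.add_apply, LinearMap.smul_apply, Matrix.entryLinearMap_apply,
          LinearMap.id_apply] at h0 ⊢
      rw [h0, divDiff]
  have hcont : WAnalyticAt K (fun t : K => divDiff a x h (x + t • h)) 0 := by
    have h1 : WAnalyticAt K (fun t : K => (!![x, h; 0, x] : Matrix (Fin 2) (Fin 2) A)
        + t • !![0, 0; 0, h]) 0 := by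
      refine (WAnalyticAt.const _ _).add fun w => ?_
      simp only [map_smul, smul_eq_mul]
      fun_prop
    have h2 := (h1.evalSeries ha).linear (Matrix.entryLinearMap K A 0 1)
    simpa [divDiff] using h2
  intro w
  obtain ⟨c', hc'⟩ := hcont.exists_hasWDerivAt
  have h3 : (fun s : K => w (evalSeries a (x + s • h))) = fun s =>
      w (evalSeries a x) + s * w (divDiff a x h (x + s • h)) := by
    funext s
    rw [key, map_add, map_smul, smul_eq_mul]
  rw [h3]
  have h4 := ((hasDerivAt_id (0 : K)).mul (hc' w)).const_add (w (evalSeries a x))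
  simpa using h4

end DividedDifference

/-! ### The series of `exp z`, `sinh z / z`, `(z cosh z - sinh z) / z²` and `(exp z - 1) / z` -/

section Coefficients

variable {K : Type*} [RCLike K]

/-- Coefficients of `exp z`; by definition `expEnd f = evalSeries (expCoeff K) f`. -/
def expCoeff (K : Type*) [RCLike K] (n : ℕ) : K := ((n.factorial : ℕ) : K)⁻¹

/-- Coefficients of `(exp z - 1) / z`. -/
def expSubOneCoeff (K : Type*) [RCLike K] (n : ℕ) : K := (((n + 1).factorial : ℕ) : K)⁻¹

theorem isEntire_of_norm_le {a : ℕ → K} (h : ∀ n, ‖a n‖ ≤ ((n.factorial : ℕ) : ℝ)⁻¹) :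
    IsEntire a := fun r => by
  refine .of_norm_bounded (Real.summable_pow_div_factorial |r|) fun n => ?_
  rw [norm_mul, norm_norm, norm_pow, Real.norm_eq_abs, div_eq_inv_mul]
  gcongr
  exact h n

theorem isEntire_expCoeff : IsEntire (expCoeff K) :=
  isEntire_of_norm_le fun n => by simp [expCoeff]

theorem isEntire_expSubOneCoeff : IsEntire (expSubOneCoeff K) :=
  isEntire_of_norm_le fun n => by
    simp only [expSubOneCoeff, norm_inv, RCLike.norm_natCast]
    gcongr
    omega

theorem isEntire_denCoeff : IsEntire (denCoeff K) :=
  isEntire_of_norm_le fun n => by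
    unfold denCoeff
    split_ifs
    · simp only [norm_inv, RCLike.norm_natCast]
      gcongr
      omega
    · simp

theorem isEntire_numCoeff : IsEntire (numCoeff K) :=
  isEntire_of_norm_le fun n => by
    unfold numCoeff
    split_ifs
    · simp only [norm_div, RCLike.norm_natCast]
      rw [Nat.factorial_succ, Nat.factorial_succ, div_le_iff₀ (by positivity)]
      have : (0 : ℝ) < (n.factorial : ℕ) := by positivity
      push_cast
      field_simp
      nlinarith
    · simp

variable {A : Type*} [Ring A] [Algebra K A] [FiniteDimensional K A] (x : A)

theorem evalSeries_denCoeff_neg :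
    evalSeries (denCoeff K) (-x) = evalSeries (denCoeff K) x :=
  isEntire_denCoeff.evalSeries_neg isEntire_denCoeff (fun n => by
    unfold denCoeff
    split_ifs with h
    · simp [h.neg_one_pow]
    · simp) x

theorem evalSeries_numCoeff_neg :
    evalSeries (numCoeff K) (-x) = -evalSeries (numCoeff K) x := by
  refine eq_of_forall_dual_apply (K := K) fun w => ?_
  refine (isEntire_numCoeff.hasSum (-x) w).unique ?_
  rw [map_neg]
  refine (isEntire_numCoeff.hasSum x w).neg.congr_fun fun n => ?_
  rw [← neg_one_smul K x, smul_pow, map_smul, smul_eq_mul, numCoeff]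
  split_ifs with h
  · simp [h.neg_one_pow]
  · simp

theorem isEntire_single : IsEntire (Pi.single 0 1 : ℕ → K) := fun r =>
  summable_of_ne_finset_zero (s := {0}) fun n hn => by simp [Finset.notMem_singleton.1 hn]

theorem evalSeries_single : evalSeries (Pi.single 0 1 : ℕ → K) x = 1 := by
  refine eq_of_forall_dual_apply (K := K) fun w => (isEntire_single.hasSum x w).unique ?_
  convert hasSum_single (f := fun n => (Pi.single 0 1 : ℕ → K) n * w (x ^ n)) 0 fun n hn => ?_
    using 1
  · simp
  · simp [hn]

/-- `exp z = cosh z + sinh z`, written as `exp z = S + z N + z S` with `S = sinh z / z` and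
`N = (z cosh z - sinh z) / z²`. -/
theorem evalSeries_expCoeff : evalSeries (expCoeff K) x =
    evalSeries (denCoeff K) x + x * evalSeries (numCoeff K) x
      + x * evalSeries (denCoeff K) x := by
  refine eq_of_forall_dual_apply (K := K) fun w => ?_
  refine (isEntire_expCoeff.hasSum x w).unique ?_
  have h1 := isEntire_denCoeff.hasSum x w
  have h2 := (isEntire_numCoeff.hasSum x (w ∘ₗ LinearMap.mulLeft K x)).add
    (isEntire_denCoeff.hasSum x (w ∘ₗ LinearMap.mulLeft K x))
  rw [← hasSum_nat_add_iff' 1] at h1 ⊢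
  convert h1.add h2 using 1
  · funext n
    simp only [LinearMap.comp_apply, LinearMap.mulLeft_apply, ← pow_succ', ← add_mul]
    congr 1
    have h0 : (((n + 1).factorial : ℕ) : K) ≠ 0 := by exact_mod_cast Nat.factorial_ne_zero _
    have h3 : (n : K) + 2 ≠ 0 := by exact_mod_cast (Nat.succ_ne_zero (n + 1))
    have h4 : (((n + 2).factorial : ℕ) : K) = (n + 2) * (((n + 1).factorial : ℕ) : K) := by
      rw [Nat.factorial_succ]; push_cast; ring
    rcases Nat.even_or_odd n with h | h
    · simp [expCoeff, denCoeff, numCoeff, h, Nat.even_add_one]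
    · have : ¬ Even n := by simpa using h
      simp only [expCoeff, denCoeff, numCoeff, h, this, Nat.even_add_one, if_true, if_false,
        not_false_eq_true, add_assoc, Nat.reduceAdd, h4]
      push_cast
      field_simp
      ring
  · simp [expCoeff, denCoeff]
    abel

theorem evalSeries_expCoeff_eq_one_add :
    evalSeries (expCoeff K) x = 1 + x * evalSeries (expSubOneCoeff K) x := by
  rw [isEntire_expSubOneCoeff.evalSeries_shift isEntire_expCoeff (fun n => rfl)]
  simp [expCoeff]

theorem evalSeries_expSubOneCoeff_add_neg :
    evalSeries (expSubOneCoeff K) x + evalSeries (expSubOneCoeff K) (-x)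
      = 2 * evalSeries (denCoeff K) x := by
  refine eq_of_forall_dual_apply (K := K) fun w => ?_
  rw [map_add, two_mul, map_add]
  refine ((isEntire_expSubOneCoeff.hasSum x w).add
    (isEntire_expSubOneCoeff.hasSum (-x) w)).unique ?_
  convert (isEntire_denCoeff.hasSum x w).add (isEntire_denCoeff.hasSum x w) using 2 with n
  rw [← neg_one_smul K x, smul_pow, map_smul, smul_eq_mul, denCoeff, expSubOneCoeff]
  split_ifs with h
  · simp [h.neg_one_pow]
  · simp [(Nat.not_even_iff_odd.1 h).neg_one_pow]

theorem evalSeries_expCoeff_add {x y : A} (h : Commute x y) :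
    evalSeries (expCoeff K) (x + y) = evalSeries (expCoeff K) x * evalSeries (expCoeff K) y := by
  rename_i r al _
  obtain ⟨i, j, rfl, h'⟩ := exists_normedAlgebra K A
  obtain rfl := eq_of_heq h'
  have : CompleteSpace A := FiniteDimensional.complete K A
  let := NormedAlgebra.restrictScalars ℚ K A
  have he : ∀ z : A, evalSeries (expCoeff K) z = NormedSpace.exp z := fun z => by
    rw [evalSeries_eq_tsum, NormedSpace.exp_eq_tsum K]; rfl
  rw [he, he, he, NormedSpace.exp_add_of_commute h]

theorem evalSeries_expCoeff_mul_neg :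
    evalSeries (expCoeff K) x * evalSeries (expCoeff K) (-x) = 1 := by
  rw [← evalSeries_expCoeff_add (Commute.neg_right (Commute.refl x)), add_neg_cancel,
    evalSeries_zero isEntire_expCoeff]
  simp [expCoeff]

theorem commute_num_den : Commute (evalSeries (numCoeff K) x) (evalSeries (denCoeff K) x) :=
  isEntire_denCoeff.commute_evalSeries
    (isEntire_numCoeff.commute_evalSeries (Commute.refl x)).symm

/-- The function `(1 - exp (-z)) / z * S z - exp (-z) * (S z + N z)` is odd; after division by
`S z` it is `1 / z - 1 / sinh z`. -/
theorem expSubOne_mul_den_add_neg :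
    evalSeries (expSubOneCoeff K) (-x) * evalSeries (denCoeff K) x
        + evalSeries (expSubOneCoeff K) x * evalSeries (denCoeff K) x
      = evalSeries (expCoeff K) (-x) * (evalSeries (denCoeff K) x + evalSeries (numCoeff K) x)
        + evalSeries (expCoeff K) x
          * (evalSeries (denCoeff K) x - evalSeries (numCoeff K) x) := by
  have h := (commute_num_den (K := K) x).eq
  rw [← add_mul, add_comm (evalSeries (expSubOneCoeff K) (-x)), evalSeries_expSubOneCoeff_add_neg,
    evalSeries_expCoeff, evalSeries_expCoeff, evalSeries_denCoeff_neg, evalSeries_numCoeff_neg]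
  simp only [two_mul, add_mul, mul_add, mul_sub, neg_mul, mul_neg, neg_neg,
    mul_assoc, h]
  abel

end Coefficients

/-! ### Functional identities in commutative algebras -/

section Commutative

variable {K : Type*} [RCLike K] {A : Type*} [CommRing A] [Algebra K A]

/-- An identity of analytic functions which holds after multiplication by a generically invertible
function holds. -/
theorem WAnalyticAt.eq_zero_of_mul_eq_zero {p G : K → A} (hG : WAnalyticAt K G 0)
    (hp : ∀ᶠ t in 𝓝[≠] (0 : K), IsUnit (p t)) (h : ∀ t, p t * G t = 0) : G 0 = 0 := by
  refine eq_of_forall_dual_apply (K := K) fun w => ?_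
  have h1 : Filter.Tendsto (fun t => w (G t)) (𝓝[≠] 0) (𝓝 (w (G 0))) :=
    (hG.continuousAt w).mono_left nhdsWithin_le_nhds
  have h2 : (fun t => w (G t)) =ᶠ[𝓝[≠] 0] fun _ => 0 := by
    filter_upwards [hp] with t ht
    rw [(ht.mul_right_eq_zero).1 (h t), map_zero]
  rw [map_zero]
  exact tendsto_nhds_unique (h1.congr' h2) tendsto_const_nhds

theorem wAnalyticAt_add_smul (x : A) (c t : K) :
    WAnalyticAt K (fun t : K => x + (t * c) • (1 : A)) t := fun w => by
  simp only [map_add, map_smul, smul_eq_mul]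
  fun_prop

variable [FiniteDimensional K A]

theorem eventually_isUnit_add_smul (x : A) {c : K} (hc : c ≠ 0) :
    ∀ᶠ t in 𝓝[≠] (0 : K), IsUnit (x + (t * c) • (1 : A)) := by
  have hfin : {t : K | -(t * c) ∈ spectrum K (LinearMap.mulLeft K x)}.Finite :=
    (Module.End.finite_spectrum (LinearMap.mulLeft K x)).preimage
      (f := fun t : K => -(t * c)) fun s _ t _ h => by
        simpa [hc] using h
  have h1 := (hfin.subset (Set.sdiff_subset (t := {(0 : K)}))).isClosed.isOpen_compl.mem_nhds
    (x := (0 : K)) (by simp)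
  filter_upwards [nhdsWithin_le_nhds h1, self_mem_nhdsWithin] with t ht ht0
  have h2 : -(t * c) ∉ spectrum K (LinearMap.mulLeft K x) := fun h => ht ⟨h, ht0⟩
  rw [spectrum.notMem_iff, Module.End.isUnit_iff] at h2
  obtain ⟨y, hy⟩ := h2.2 (-1)
  refine IsUnit.of_mul_eq_one y ?_
  simp only [LinearMap.sub_apply, algebraMap_end_apply, LinearMap.mulLeft_apply, neg_smul] at hy
  rw [add_mul, smul_mul_assoc, one_mul]
  linear_combination -hy

theorem divDiff_mul_sub {a : ℕ → K} (ha : IsEntire a) (x y : A) :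
    divDiff a x 1 y * (x - y) = evalSeries a x - evalSeries a y := by
  have h0 := ha.map_evalSeries_eq (x := !![x, 1; 0, y])
    (Matrix.entryLinearMap K A 0 0) LinearMap.id (y := x) fun n => by simp [block_pow]
  have h1 := ha.map_evalSeries_eq (x := !![x, 1; 0, y])
    (Matrix.entryLinearMap K A 1 1) LinearMap.id (y := y) fun n => by simp [block_pow]
  have h2 := ha.map_evalSeries_eq (x := !![x, 1; 0, y]) (y := !![x, 1; 0, y])
    (LinearMap.mulRight K (x - y) ∘ₗ Matrix.entryLinearMap K A 0 1)
    (Matrix.entryLinearMap K A 0 0 - Matrix.entryLinearMap K A 1 1) fun n => by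
      simpa [block_pow, Finset.sum_mul] using (Commute.all x y).geom_sum₂_mul n
  simp only [LinearMap.comp_apply, LinearMap.mulRight_apply, Matrix.entryLinearMap_apply,
    LinearMap.sub_apply, LinearMap.id_apply] at h0 h1 h2
  rw [divDiff, h2, h0, h1]

theorem WAnalyticAt.divDiff {E : Type*} [NormedAddCommGroup E] [NormedSpace K E] {a : ℕ → K}
    (ha : IsEntire a) {f h : E → A} {x : E} (hf : WAnalyticAt K f x) (hh : WAnalyticAt K h x) :
    WAnalyticAt K (fun y => divDiff a (f y) 1 (h y)) x := by
  have h1 : WAnalyticAt K (fun y => !![f y, 1; 0, h y]) x := by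
    have e : (fun y => !![f y, 1; 0, h y]) = fun y =>
        Matrix.singleLinearMap K (0 : Fin 2) (0 : Fin 2) (f y)
        + Matrix.singleLinearMap K (1 : Fin 2) (1 : Fin 2) (h y) + !![0, 1; 0, 0] := by
      funext y
      ext i j
      fin_cases i <;> fin_cases j <;> simp [Matrix.singleLinearMap, Matrix.single]
    rw [e]
    exact ((hf.linear _).add (hh.linear _)).add (WAnalyticAt.const _ _)
  exact (h1.evalSeries ha).linear (Matrix.entryLinearMap K A 0 1)

/-- The divided difference of `exp` at `b, a + b`, that is
`(exp (a + b) - exp b) / a = (exp a - 1) / a * exp b`. -/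
theorem divDiff_expCoeff {a b c : A} (h : a + b + c = 0) :
    divDiff (expCoeff K) b 1 (-c)
      = evalSeries (expSubOneCoeff K) a * evalSeries (expCoeff K) b := by
  -- The identity multiplied by `a` is elementary; `a` is cancelled after perturbing it to a unit.
  have key : ∀ a b : A, a * (divDiff (expCoeff K) b 1 (a + b)
      - evalSeries (expSubOneCoeff K) a * evalSeries (expCoeff K) b) = 0 := by
    intro a b
    have h1 := divDiff_mul_sub (K := K) isEntire_expCoeff b (a + b)
    rw [evalSeries_expCoeff_add (Commute.all a b)] at h1
    have h2 := evalSeries_expCoeff_eq_one_add (K := K) a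
    linear_combination -h1 + evalSeries (expCoeff K) b * h2
  have hc : -c = a + b := by linear_combination -h
  have hG : WAnalyticAt K (fun t : K => divDiff (expCoeff K) b 1 (a + (t * 1) • 1 + b)
      - evalSeries (expSubOneCoeff K) (a + (t * 1) • 1) * evalSeries (expCoeff K) b) 0 := by
    have ha := wAnalyticAt_add_smul a 1 (0 : K)
    exact (WAnalyticAt.divDiff isEntire_expCoeff (.const _ _) (ha.add (.const _ _))).sub
      ((ha.evalSeries isEntire_expSubOneCoeff).mul (.const _ _))
  have := hG.eq_zero_of_mul_eq_zero (eventually_isUnit_add_smul a one_ne_zero) fun t => key _ _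
  rw [hc, ← sub_eq_zero]
  simpa using this

/-- The identity of entire functions in `a + b + c = 0` behind the Alekseev-Meinrenken r-matrix. For
`F = N / S`, whose divided differences are given by `S` and `N`, it states
`∑ (F (a + b) - F b) / a = F a F b + F b F c + F c F a + 1`. -/
theorem divDiff_num_den_identity {a b c : A} (h : a + b + c = 0) :
    let S : A → A := evalSeries (denCoeff K)
    let N : A → A := evalSeries (numCoeff K)
    let D : A → A → A := fun y z =>
      S z * divDiff (numCoeff K) y 1 (-z) + N z * divDiff (denCoeff K) y 1 (-z)
    S a * D b c + S b * D c a + S c * D a b =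
      N a * N b * S c + N b * N c * S a + N c * N a * S b + S a * S b * S c := by
  intro S N D
  have hD : ∀ a b c : A, a + b + c = 0 → a * D b c = -(S c * N b + N c * S b) := by
    intro a b c h
    have h1 := divDiff_mul_sub (K := K) isEntire_numCoeff b (-c)
    have h2 := divDiff_mul_sub (K := K) isEntire_denCoeff b (-c)
    rw [evalSeries_numCoeff_neg] at h1
    rw [evalSeries_denCoeff_neg] at h2
    change _ = N b - -N c at h1
    change _ = S b - S c at h2
    simp only [D]
    linear_combination -S c * h1 - N c * h2
      + (S c * divDiff (numCoeff K) b 1 (-c) + N c * divDiff (denCoeff K) b 1 (-c)) * h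
  -- Multiplied by `a b c`, the identity is half the difference of `exp a exp b exp c = 1` and
  -- `exp (-a) exp (-b) exp (-c) = 1`.
  have key : ∀ a b c : A, a + b + c = 0 → (a * b * c) * (S a * D b c + S b * D c a + S c * D a b -
      (N a * N b * S c + N b * N c * S a + N c * N a * S b + S a * S b * S c)) = 0 := by
    intro a b c h
    have hE : ∀ a b c : A, a + b + c = 0 →
        (S a + a * N a + a * S a) * (S b + b * N b + b * S b) * (S c + c * N c + c * S c) = 1 := by
      intro a b c h
      rw [← evalSeries_expCoeff, ← evalSeries_expCoeff, ← evalSeries_expCoeff,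
        ← evalSeries_expCoeff_add (Commute.all _ _), ← evalSeries_expCoeff_add (Commute.all _ _), h,
        evalSeries_zero isEntire_expCoeff]
      simp [expCoeff]
    have h1 := hE a b c h
    have h2 := hE (-a) (-b) (-c) (by linear_combination -h)
    simp only [S, N, evalSeries_numCoeff_neg, evalSeries_denCoeff_neg] at h2
    change (S a + -a * -N a + -a * S a) * (S b + -b * -N b + -b * S b)
      * (S c + -c * -N c + -c * S c) = 1 at h2
    have ha := hD a b c h
    have hb := hD b c a (by linear_combination h)
    have hc := hD c a b (by linear_combination h)
    generalize D b c = Da at *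
    generalize D c a = Db at *
    generalize D a b = Dc at *
    have h3 : (2 : K) • ((a * b * c) * (S a * Da + S b * Db + S c * Dc -
      (N a * N b * S c + N b * N c * S a + N c * N a * S b + S a * S b * S c))) = 0 := by
      rw [two_smul]
      linear_combination 2 * b * c * S a * ha + 2 * c * a * S b * hb + 2 * a * b * S c * hc
        - h1 + h2 + 2 * S a * S b * S c * h
    exact (smul_eq_zero.1 h3).resolve_left two_ne_zero
  -- The factor `a b c` is cancelled along the perturbation `(a + t, b + t, c - 2 t)`, which keeps
  -- the sum zero.
  have hG : WAnalyticAt K (fun t : K => (fun a b c => S a * D b c + S b * D c a + S c * D a b -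
      (N a * N b * S c + N b * N c * S a + N c * N a * S b + S a * S b * S c))
      (a + (t * 1) • 1) (b + (t * 1) • 1) (c + (t * -2) • 1)) 0 := by
    have ha := wAnalyticAt_add_smul a 1 (0 : K)
    have hb := wAnalyticAt_add_smul b 1 (0 : K)
    have hc := wAnalyticAt_add_smul c (-2) (0 : K)
    have hS : ∀ {f : K → A}, WAnalyticAt K f 0 → WAnalyticAt K (fun t => S (f t)) 0 :=
      fun hf => hf.evalSeries isEntire_denCoeff
    have hN : ∀ {f : K → A}, WAnalyticAt K f 0 → WAnalyticAt K (fun t => N (f t)) 0 :=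
      fun hf => hf.evalSeries isEntire_numCoeff
    have hD : ∀ {f g : K → A}, WAnalyticAt K f 0 → WAnalyticAt K g 0 →
        WAnalyticAt K (fun t => D (f t) (g t)) 0 := fun hf hg =>
      ((hS hg).mul (.divDiff isEntire_numCoeff hf (hg.linear (-LinearMap.id)))).add
        ((hN hg).mul (.divDiff isEntire_denCoeff hf (hg.linear (-LinearMap.id))))
    exact ((((hS ha).mul (hD hb hc)).add ((hS hb).mul (hD hc ha))).add
      ((hS hc).mul (hD ha hb))).sub ((((((hN ha).mul (hN hb)).mul (hS hc)).add
        (((hN hb).mul (hN hc)).mul (hS ha))).add (((hN hc).mul (hN ha)).mul (hS hb))).add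
        (((hS ha).mul (hS hb)).mul (hS hc)))
  have hu : ∀ᶠ t in 𝓝[≠] (0 : K), IsUnit
      ((a + (t * 1) • 1) * (b + (t * 1) • 1) * (c + (t * -2) • (1 : A))) := by
    filter_upwards [eventually_isUnit_add_smul a (one_ne_zero (α := K)),
      eventually_isUnit_add_smul b (one_ne_zero (α := K)),
      eventually_isUnit_add_smul c (c := (-2 : K)) (by norm_num)] with t h1 h2 h3
    exact (h1.mul h2).mul h3
  have := hG.eq_zero_of_mul_eq_zero hu fun t => key _ _ _ (by
    have : a + (t * 1) • 1 + (b + (t * 1) • 1) + (c + (t * -2) • (1 : A))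
      = (a + b + c) + (t * 1 + t * 1 + t * -2) • (1 : A) := by module
    rw [this, h]
    ring_nf
    simp)
  rw [← sub_eq_zero]
  simpa using this

end Commutative

/-! ### Invariant trilinear forms -/

section Trilinear

universe u v

variable {K : Type u} [Field K] {V : Type v} [AddCommGroup V] [Module K V] [FiniteDimensional K V]

/-- Trilinear forms on `V`. -/
abbrev TrilinearForm (K : Type u) (V : Type v) [Field K] [AddCommGroup V] [Module K V] :=
  V →ₗ[K] V →ₗ[K] V →ₗ[K] K

/-- Two commuting endomorphisms of a module generate a commutative algebra. -/
theorem exists_commRing_of_commute {M : Type v} [AddCommGroup M] [Module K M]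
    [FiniteDimensional K M] {a₀ b₀ : End K M} (h : a₀ * b₀ = b₀ * a₀) :
    ∃ (A : Type v) (_ : CommRing A) (_ : Algebra K A) (_ : FiniteDimensional K A)
      (φ : A →ₐ[K] End K M) (a b : A), φ a = a₀ ∧ φ b = b₀ := by
  have := Algebra.isMulCommutative_adjoin K (s := {a₀, b₀}) (by
    rintro x (rfl | rfl) y (rfl | rfl) <;> first | rfl | exact h | exact h.symm)
  let i : CommRing (Algebra.adjoin K {a₀, b₀}) :=
    { (Algebra.adjoin K {a₀, b₀}).toRing with
      mul_comm := fun x y => this.is_comm.comm x y }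
  exact ⟨Algebra.adjoin K {a₀, b₀}, i, (Algebra.adjoin K {a₀, b₀}).algebra,
    inferInstanceAs (FiniteDimensional K (Algebra.adjoin K {a₀, b₀})), Subalgebra.val _,
    ⟨a₀, Algebra.subset_adjoin (by simp)⟩, ⟨b₀, Algebra.subset_adjoin (by simp)⟩, rfl, rfl⟩

/-- For a trilinear form `τ` invariant under `P`, the operators "apply `P` in the first, second,
third slot" generate a commutative algebra in which their sum is zero. -/
theorem exists_slotAlgebra {τ : TrilinearForm K V} {P : End K V}
    (h : ∀ X Y Z, τ (P X) Y Z + τ X (P Y) Z + τ X Y (P Z) = 0) :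
    ∃ (A : Type (max u v)) (_ : CommRing A) (_ : Algebra K A) (_ : FiniteDimensional K A)
      (a b c : A) (ev : A →ₗ[K] TrilinearForm K V), a + b + c = 0 ∧
      ∀ (i j k : ℕ) (X Y Z : V),
        ev (a ^ i * b ^ j * c ^ k) X Y Z = τ ((P ^ i) X) ((P ^ j) Y) ((P ^ k) Z) := by
  let opA : End K (TrilinearForm K V) := LinearMap.lcomp K _ P
  let opB : End K (TrilinearForm K V) :=
    LinearMap.llcomp K V _ _ (LinearMap.lcomp K (V →ₗ[K] K) P)
  let opC : End K (TrilinearForm K V) :=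
    LinearMap.llcomp K V _ _ (LinearMap.llcomp K V _ _ (LinearMap.lcomp K K P))
  have hA : ∀ (σ : TrilinearForm K V) X Y Z, opA σ X Y Z = σ (P X) Y Z := fun σ X Y Z => rfl
  have hB : ∀ (σ : TrilinearForm K V) X Y Z, opB σ X Y Z = σ X (P Y) Z := fun σ X Y Z => rfl
  have hC : ∀ (σ : TrilinearForm K V) X Y Z, opC σ X Y Z = σ X Y (P Z) := fun σ X Y Z => rfl
  let I : Submodule K (TrilinearForm K V) := LinearMap.ker (opA + opB + opC)
  have hI : ∀ {σ : TrilinearForm K V},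
      σ ∈ I ↔ ∀ X Y Z, σ (P X) Y Z + σ X (P Y) Z + σ X Y (P Z) = 0 := by
    intro σ
    constructor
    · intro hσ X Y Z
      exact DFunLike.congr_fun (DFunLike.congr_fun (DFunLike.congr_fun hσ X) Y) Z
    · intro hσ
      exact LinearMap.ext fun X => LinearMap.ext fun Y => LinearMap.ext fun Z => hσ X Y Z
  let a₀ : End K I := opA.restrict (p := I) (q := I) fun σ hσ => hI.2 fun X Y Z => by
    simpa only [hA] using hI.1 hσ (P X) Y Z
  let b₀ : End K I := opB.restrict (p := I) (q := I) fun σ hσ => hI.2 fun X Y Z => by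
    simpa only [hB] using hI.1 hσ X (P Y) Z
  have ha₀ : ∀ (σ : I) X Y Z, (a₀ σ).1 X Y Z = σ.1 (P X) Y Z := fun σ X Y Z => rfl
  have hb₀ : ∀ (σ : I) X Y Z, (b₀ σ).1 X Y Z = σ.1 X (P Y) Z := fun σ X Y Z => rfl
  -- The third slot operator is `-(a + b)` on the forms invariant under `P`.
  have hcomm : a₀ * b₀ = b₀ * a₀ := rfl
  obtain ⟨S, _, _, _, φ, a, b, ha, hb⟩ :=
    exists_commRing_of_commute (M := I) (a₀ := a₀) (b₀ := b₀) hcomm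
  have hc : ∀ (σ : I) X Y Z, (φ (-(a + b)) σ).1 X Y Z = σ.1 X Y (P Z) := by
    intro σ X Y Z
    have := hI.1 σ.2 X Y Z
    rw [← neg_one_smul K (a + b), map_smul, map_add, ha, hb]
    change (-1 : K) * (σ.1 (P X) Y Z + σ.1 X (P Y) Z) = _
    linear_combination -this
  have hai : ∀ (i : ℕ) (σ : I) X Y Z, ((a₀ ^ i) σ).1 X Y Z = σ.1 ((P ^ i) X) Y Z := by
    intro i
    induction i with
    | zero => intro σ X Y Z; rfl
    | succ i ih =>
      intro σ X Y Z
      rw [pow_succ', pow_succ]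
      exact (ha₀ _ X Y Z).trans (ih _ _ _ _)
  have hbi : ∀ (i : ℕ) (σ : I) X Y Z, ((b₀ ^ i) σ).1 X Y Z = σ.1 X ((P ^ i) Y) Z := by
    intro i
    induction i with
    | zero => intro σ X Y Z; rfl
    | succ i ih =>
      intro σ X Y Z
      rw [pow_succ', pow_succ]
      exact (hb₀ _ X Y Z).trans (ih _ _ _ _)
  have hci : ∀ (i : ℕ) (σ : I) X Y Z, ((φ (-(a + b)) ^ i) σ).1 X Y Z = σ.1 X Y ((P ^ i) Z) := by
    intro i
    induction i with
    | zero => intro σ X Y Z; rfl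
    | succ i ih =>
      intro σ X Y Z
      rw [pow_succ', pow_succ]
      exact (hc _ X Y Z).trans (ih _ _ _ _)
  refine ⟨S, inferInstance, inferInstance, inferInstance, a, b, -(a + b),
    I.subtype ∘ₗ LinearMap.applyₗ (⟨τ, hI.2 h⟩ : I) ∘ₗ φ.toLinearMap, by ring, ?_⟩
  intro i j k X Y Z
  change (φ (a ^ i * b ^ j * (-(a + b)) ^ k) ⟨τ, hI.2 h⟩).1 X Y Z = _
  rw [map_mul, map_mul, map_pow, map_pow, map_pow, ha, hb, Module.End.mul_apply,
    Module.End.mul_apply, hai, hbi, hci]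

end Trilinear

section Commutative

variable {K : Type*} [RCLike K] {A : Type*} [CommRing A] [Algebra K A] [FiniteDimensional K A]

theorem divDiff_comm {a : ℕ → K} (ha : IsEntire a) (x y : A) :
    divDiff a x 1 y = divDiff a y 1 x := by
  refine ha.map_evalSeries_eq (Matrix.entryLinearMap K A (0 : Fin 2) (1 : Fin 2))
    (Matrix.entryLinearMap K A (0 : Fin 2) (1 : Fin 2)) fun n => ?_
  simpa [block_pow] using (Commute.all x y).geom_sum₂_comm n

end Commutative

section Slots

universe u v

variable {K : Type u} [RCLike K] {V : Type v} [AddCommGroup V] [Module K V] [FiniteDimensional K V]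
  {τ : TrilinearForm K V} {P : End K V} {A : Type*} [CommRing A] [Algebra K A]
  [FiniteDimensional K A] {a b c : A} {ev : A →ₗ[K] TrilinearForm K V}

/-- Entire functions of the slot operators in the first and third slot, powers in the second. -/
theorem slot_first_third
    (hev : ∀ (i j k : ℕ) (X Y Z : V),
      ev (a ^ i * b ^ j * c ^ k) X Y Z = τ ((P ^ i) X) ((P ^ j) Y) ((P ^ k) Z))
    {f h : ℕ → K} (hf : IsEntire f) (hh : IsEntire h) (j k : ℕ) (X Y Z : V) :
    ev (evalSeries f a * b ^ j * (c ^ k * evalSeries h c)) X Y Z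
      = τ (evalSeries f P X) ((P ^ j) Y) ((P ^ k) (evalSeries h P Z)) := by
  refine hh.map_evalSeries_eq (x := c) (y := P)
    (LinearMap.applyₗ Z ∘ₗ LinearMap.applyₗ Y ∘ₗ LinearMap.applyₗ X ∘ₗ ev ∘ₗ
      LinearMap.mulLeft K (evalSeries f a * b ^ j) ∘ₗ LinearMap.mulLeft K (c ^ k))
    (τ (evalSeries f P X) ((P ^ j) Y) ∘ₗ (P ^ k : End K V) ∘ₗ LinearMap.applyₗ Z) fun n => ?_
  change ev (evalSeries f a * b ^ j * (c ^ k * c ^ n)) X Y Z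
    = τ (evalSeries f P X) ((P ^ j) Y) ((P ^ k * P ^ n) Z)
  rw [← pow_add, ← pow_add, mul_assoc]
  refine hf.map_evalSeries_eq (x := a) (y := P)
    (LinearMap.applyₗ Z ∘ₗ LinearMap.applyₗ Y ∘ₗ LinearMap.applyₗ X ∘ₗ ev ∘ₗ
      LinearMap.mulRight K (b ^ j * c ^ (k + n)))
    (LinearMap.applyₗ ((P ^ (k + n)) Z) ∘ₗ LinearMap.applyₗ ((P ^ j) Y) ∘ₗ τ ∘ₗ
      LinearMap.applyₗ X) fun m => ?_
  simpa [mul_assoc] using hev m j (k + n) X Y Z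

/-- Entire functions of the slot operators act as entire functions of `P` in the slots. -/
theorem slot_apply
    (hev : ∀ (i j k : ℕ) (X Y Z : V),
      ev (a ^ i * b ^ j * c ^ k) X Y Z = τ ((P ^ i) X) ((P ^ j) Y) ((P ^ k) Z))
    {f g h : ℕ → K} (hf : IsEntire f) (hg : IsEntire g) (hh : IsEntire h) (X Y Z : V) :
    ev (evalSeries f a * evalSeries g b * evalSeries h c) X Y Z
      = τ (evalSeries f P X) (evalSeries g P Y) (evalSeries h P Z) := by
  refine hg.map_evalSeries_eq (x := b) (y := P)
    (LinearMap.applyₗ Z ∘ₗ LinearMap.applyₗ Y ∘ₗ LinearMap.applyₗ X ∘ₗ ev ∘ₗ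
      LinearMap.mulRight K (evalSeries h c) ∘ₗ LinearMap.mulLeft K (evalSeries f a))
    (LinearMap.applyₗ (evalSeries h P Z) ∘ₗ τ (evalSeries f P X) ∘ₗ LinearMap.applyₗ Y)
    fun n => ?_
  simpa using slot_first_third hev hf hh n 0 X Y Z

/-- If `P` is an infinitesimal symmetry of a trilinear form, then `exp P` preserves the form. -/
theorem exp_invariant (h : ∀ X Y Z, τ (P X) Y Z + τ X (P Y) Z + τ X Y (P Z) = 0) (X Y Z : V) :
    τ (evalSeries (expCoeff K) P X) (evalSeries (expCoeff K) P Y) (evalSeries (expCoeff K) P Z)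
      = τ X Y Z := by
  obtain ⟨A, _, _, _, a, b, c, ev, habc, hev⟩ := exists_slotAlgebra h
  rw [← slot_apply hev isEntire_expCoeff isEntire_expCoeff isEntire_expCoeff,
    ← evalSeries_expCoeff_add (Commute.all _ _), ← evalSeries_expCoeff_add (Commute.all _ _), habc,
    evalSeries_zero isEntire_expCoeff]
  simpa [expCoeff] using hev 0 0 0 X Y Z

end Slots

/-! ### The function `coth z - 1 / z` of an endomorphism -/

section Coth

variable {K : Type*} [RCLike K] {V : Type*} [AddCommGroup V] [Module K V] {f : End K V}

theorem cothSubInv_mul_den (hu : IsUnit (evalSeries (denCoeff K) f)) :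
    cothSubInv f * evalSeries (denCoeff K) f = evalSeries (numCoeff K) f := by
  change evalSeries _ _ * Ring.inverse (evalSeries _ _) * _ = _
  rw [mul_assoc, Ring.inverse_mul_cancel _ hu, mul_one]

theorem cothSubInv_apply_den (hu : IsUnit (evalSeries (denCoeff K) f)) (v : V) :
    cothSubInv f (evalSeries (denCoeff K) f v) = evalSeries (numCoeff K) f v := by
  rw [← Module.End.mul_apply, cothSubInv_mul_den hu]

variable [FiniteDimensional K V]

theorem WAnalyticAt.cothSubInv {E : Type*} [NormedAddCommGroup E] [NormedSpace K E]
    {c : E → End K V} {x : E} (hc : WAnalyticAt K c x)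
    (hu : IsUnit (LieQuasi.evalSeries (denCoeff K) (c x))) :
    WAnalyticAt K (fun y => LieQuasi.cothSubInv (c y)) x :=
  (hc.evalSeries isEntire_numCoeff).mul ((hc.evalSeries isEntire_denCoeff).ringInverse hu)

theorem wAnalyticAt_add_smul_const {W : Type*} [AddCommGroup W] [Module K W] (v w : W) (t : K) :
    WAnalyticAt K (fun t : K => v + t • w) t := fun u => by
  simp only [map_add, map_smul, smul_eq_mul]
  fun_prop

/-- The derivative of `F = N S⁻¹` along a line, in a form free of inverses. -/
theorem HasWDerivAt.cothSubInv_mul_den {h F' : End K V}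
    (hF : HasWDerivAt (fun t : K => cothSubInv (f + t • h)) F' 0)
    (hu : IsUnit (evalSeries (denCoeff K) f)) :
    F' * evalSeries (denCoeff K) f + cothSubInv f * divDiff (denCoeff K) f h f
      = divDiff (numCoeff K) f h f := by
  have hN := hasWDerivAt_evalSeries (isEntire_numCoeff (K := K)) f h
  have hS := hasWDerivAt_evalSeries (isEntire_denCoeff (K := K)) f h
  have hopen := (isOpen_setOf_isUnit fun t =>
    (wAnalyticAt_add_smul_const f h t).evalSeries (isEntire_denCoeff (K := K)))
  have hmem := hopen.mem_nhds (x := (0 : K)) (by simpa using hu)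
  have hprod : HasWDerivAt (fun t : K => evalSeries (numCoeff K) (f + t • h))
      (F' * evalSeries (denCoeff K) (f + (0 : K) • h)
        + cothSubInv (f + (0 : K) • h) * divDiff (denCoeff K) f h f) 0 := by
    intro w
    refine (hF.bilinear hS (LinearMap.mul K (End K V)) w).congr_of_eventuallyEq ?_
    filter_upwards [hmem] with t ht
    exact congrArg w (LieQuasi.cothSubInv_mul_den ht).symm
  simpa using hprod.unique hN

end Coth

/-! ### Quadratic Lie algebras and the Alekseev-Meinrenken r-matrix -/

section Quadratic

universe u v

variable {K : Type u} [RCLike K] {V : Type v} [AddCommGroup V] [Module K V]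

/-- `br` is a Lie bracket on `V` and `B` is an invariant symmetric bilinear form. -/
structure IsQuadraticLie (br : V →ₗ[K] V →ₗ[K] V) (B : V →ₗ[K] V →ₗ[K] K) : Prop where
  lie_skew : ∀ X Y, br X Y = -br Y X
  jacobi : ∀ X Y Z, br X (br Y Z) + br Y (br Z X) + br Z (br X Y) = 0
  symm : ∀ X Y, B X Y = B Y X
  cyclic : ∀ X Y Z, B (br X Y) Z = B (br Y Z) X

namespace IsQuadraticLie

variable {br : V →ₗ[K] V →ₗ[K] V} {B : V →ₗ[K] V →ₗ[K] K} (hQ : IsQuadraticLie br B)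
include hQ

theorem form_skew (W X Y : V) : B (br W X) Y = -B X (br W Y) := by
  rw [hQ.cyclic, hQ.cyclic, hQ.lie_skew Y W, map_neg, LinearMap.neg_apply, hQ.symm]

theorem leibniz (W X Y : V) : br W (br X Y) = br (br W X) Y + br X (br W Y) := by
  have h := hQ.jacobi W X Y
  rw [hQ.lie_skew Y W, map_neg, hQ.lie_skew Y (br W X)] at h
  rw [← sub_eq_zero, ← h]
  abel

theorem deriv_trilinear (W X Y Z : V) :
    br.compr₂ B (br W X) Y Z + br.compr₂ B X (br W Y) Z + br.compr₂ B X Y (br W Z) = 0 := by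
  simp only [LinearMap.compr₂_apply]
  have h := hQ.form_skew W (br X Y) Z
  rw [hQ.leibniz, map_add, LinearMap.add_apply] at h
  linear_combination h

variable [FiniteDimensional K V]

theorem form_evalSeries {a : ℕ → K} (ha : IsEntire a) (p X Y : V) :
    B (evalSeries a (br p) X) Y = B X (evalSeries a (-br p) Y) := by
  refine ha.map_evalSeries_eq (x := br p) (y := -br p)
    (LinearMap.applyₗ Y ∘ₗ B ∘ₗ LinearMap.applyₗ X) (B X ∘ₗ LinearMap.applyₗ Y) fun n => ?_
  change B ((br p ^ n : End K V) X) Y = B X (((-br p : End K V) ^ n) Y)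
  induction n generalizing X with
  | zero => rfl
  | succ n ih =>
    rw [pow_succ, pow_succ', Module.End.mul_apply, Module.End.mul_apply, ih, hQ.form_skew]
    simp

/-- `exp (ad p)` preserves the form. -/
theorem form_exp (p X Y : V) :
    B (evalSeries (expCoeff K) (br p) X) (evalSeries (expCoeff K) (br p) Y) = B X Y := by
  rw [hQ.form_evalSeries isEntire_expCoeff, ← Module.End.mul_apply]
  have := evalSeries_expCoeff_mul_neg (K := K) (A := End K V) (-br p)
  rw [neg_neg] at this
  rw [this, Module.End.one_apply]

/-- A divided difference of `ad p` in a direction `ad X`, paired with the form: the left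
multiplications by `ad p` move to the third slot, with a sign, by invariance of the form. -/
theorem slot_divDiff {A : Type*} [CommRing A] [Algebra K A]
    [FiniteDimensional K A] {a b c : A} {ev : A →ₗ[K] TrilinearForm K V} {p : V}
    (hev : ∀ (i j k : ℕ) (X Y Z : V), ev (a ^ i * b ^ j * c ^ k) X Y Z
      = br.compr₂ B (((br p : End K V) ^ i) X) (((br p : End K V) ^ j) Y)
        (((br p : End K V) ^ k) Z))
    {f g h : ℕ → K} (hf : IsEntire f) (hg : IsEntire g) (hh : IsEntire h) (X Y Z : V) :
    ev (evalSeries f a * (evalSeries h c * divDiff g b 1 (-c))) X Y Z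
      = B (divDiff g (br p) (br (evalSeries f (br p) X)) (br p) Y) (evalSeries h (br p) Z) := by
  rw [divDiff_comm hg]
  refine map_divDiff_eq hg
    (LinearMap.applyₗ Z ∘ₗ LinearMap.applyₗ Y ∘ₗ LinearMap.applyₗ X ∘ₗ ev ∘ₗ
      LinearMap.mulLeft K (evalSeries f a) ∘ₗ LinearMap.mulLeft K (evalSeries h c))
    (LinearMap.applyₗ (evalSeries h (br p) Z) ∘ₗ B ∘ₗ LinearMap.applyₗ Y) fun i j => ?_
  have key : ∀ (i : ℕ) (X Y : V),
      B (((br p : End K V) ^ i) X) Y = (-1) ^ i * B X (((br p : End K V) ^ i) Y) := by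
    intro i
    induction i with
    | zero => intro X Y; simp
    | succ i ih =>
      intro X Y
      have e : ((br p : End K V) ^ (i + 1)) Y = br p (((br p : End K V) ^ i) Y) := by
        rw [pow_succ', Module.End.mul_apply]
      rw [e, pow_succ, Module.End.mul_apply, ih, hQ.form_skew]
      ring
  change ev (evalSeries f a * (evalSeries h c * ((-c) ^ i * 1 * b ^ j))) X Y Z
    = B (((br p : End K V) ^ i) (br (evalSeries f (br p) X) (((br p : End K V) ^ j) Y)))
      (evalSeries h (br p) Z)
  have e : evalSeries f a * (evalSeries h c * ((-c) ^ i * 1 * b ^ j))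
      = (-1 : K) ^ i • (evalSeries f a * b ^ j * (c ^ i * evalSeries h c)) := by
    rw [← neg_one_smul K c, smul_pow, Algebra.smul_def, Algebra.smul_def]
    ring
  rw [key, e, map_smul, LinearMap.smul_apply, LinearMap.smul_apply, LinearMap.smul_apply,
    slot_first_third hev hf hh, smul_eq_mul]
  rfl

/-- The derivative of `exp (ad p)` in the direction `ad X`, paired with the form:
`d exp (ad X) = ad (((exp P - 1) / P) X) exp P` with `P = ad p`. -/
theorem form_divDiff_exp (p X Y Z : V) :
    B (divDiff (expCoeff K) (br p) (br X) (br p) Y) Z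
      = B (br (evalSeries (expSubOneCoeff K) (br p) X) (evalSeries (expCoeff K) (br p) Y)) Z := by
  obtain ⟨A, _, _, _, a, b, c, ev, habc, hev⟩ := exists_slotAlgebra (hQ.deriv_trilinear p)
  have h1 := hQ.slot_divDiff hev isEntire_single isEntire_expCoeff isEntire_single X Y Z
  have h2 := slot_apply hev isEntire_expSubOneCoeff isEntire_expCoeff isEntire_single X Y Z
  simp only [evalSeries_single, one_mul, mul_one, Module.End.one_apply] at h1 h2
  rw [← h1, divDiff_expCoeff habc, h2]
  rfl

/-- `exp (ad p)` is an automorphism if the form is nondegenerate. -/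
theorem exp_bracket (hB : ∀ X, (∀ Y, B X Y = 0) → X = 0) (p X Y : V) :
    evalSeries (expCoeff K) (br p) (br X Y)
      = br (evalSeries (expCoeff K) (br p) X) (evalSeries (expCoeff K) (br p) Y) := by
  rw [← sub_eq_zero]
  refine hB _ fun Z => ?_
  have h1 := exp_invariant (hQ.deriv_trilinear p) X Y (evalSeries (expCoeff K) (-br p) Z)
  rw [← Module.End.mul_apply, evalSeries_expCoeff_mul_neg, Module.End.one_apply] at h1
  simp only [LinearMap.compr₂_apply] at h1
  rw [map_sub, LinearMap.sub_apply, h1, hQ.form_evalSeries isEntire_expCoeff, sub_self]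

/-- `F (ad p)` is skew-symmetric because `F` is odd; the statement is free of inverses. -/
theorem form_mul_inverse (p X Y : V) (hu : IsUnit (evalSeries (denCoeff K) (br p) : End K V)) :
    B (cothSubInv (br p) X) (evalSeries (denCoeff K) (br p) Y)
      = -B X (evalSeries (numCoeff K) (br p) Y) := by
  have hc := commute_num_den (K := K) (br p : End K V)
  have hS : ∀ u v, B (evalSeries (denCoeff K) (br p) u) v
      = B u (evalSeries (denCoeff K) (br p) v) := fun u v => by
    rw [hQ.form_evalSeries isEntire_denCoeff, evalSeries_denCoeff_neg]
  change B ((evalSeries (numCoeff K) (br p)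
    * Ring.inverse (evalSeries (denCoeff K) (br p))) X) _ = _
  rw [Module.End.mul_apply, hQ.form_evalSeries isEntire_numCoeff, evalSeries_numCoeff_neg,
    LinearMap.neg_apply, map_neg, ← Module.End.mul_apply, hc.eq, Module.End.mul_apply, ← hS,
    ← Module.End.mul_apply, Ring.mul_inverse_cancel _ hu, Module.End.one_apply]

/-- The derivative of `F (ad p) = N S⁻¹`, in a form free of inverses. -/
theorem form_deriv_cothSubInv {p α : V} (hu : IsUnit (evalSeries (denCoeff K) (br p) : End K V))
    {F' : End K V} (hF : HasWDerivAt (fun t : K => cothSubInv (br (p + t • α))) F' 0) (Y Z : V) :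
    B (F' (evalSeries (denCoeff K) (br p) Y)) (evalSeries (denCoeff K) (br p) Z)
      = B (divDiff (numCoeff K) (br p) (br α) (br p) Y) (evalSeries (denCoeff K) (br p) Z)
        + B (divDiff (denCoeff K) (br p) (br α) (br p) Y) (evalSeries (numCoeff K) (br p) Z) := by
  have hlin : ∀ t : K, (br (p + t • α) : End K V) = br p + t • br α := fun t => by simp
  simp only [hlin] at hF
  have h := congrArg (fun T : End K V => B (T Y) (evalSeries (denCoeff K) (br p) Z))
    (hF.cothSubInv_mul_den hu)
  simp only [LinearMap.add_apply, Module.End.mul_apply, map_add,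
    hQ.form_mul_inverse p _ _ hu] at h
  linear_combination h

/-- The modified classical dynamical Yang-Baxter equation for the Alekseev-Meinrenken r-matrix
`F (ad p)`, `F z = coth z - 1 / z`, on a Lie algebra with an invariant form. -/
theorem alekseevMeinrenken {p α β γ : V}
    (hu : IsUnit (evalSeries (denCoeff K) (br p) : End K V)) {Fα Fβ Fγ : End K V}
    (hα : HasWDerivAt (fun t : K => cothSubInv (br (p + t • α))) Fα 0)
    (hβ : HasWDerivAt (fun t : K => cothSubInv (br (p + t • β))) Fβ 0)
    (hγ : HasWDerivAt (fun t : K => cothSubInv (br (p + t • γ))) Fγ 0) :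
    B (Fα β) γ + B (Fβ γ) α + B (Fγ α) β
      = B (br (cothSubInv (br p) α) (cothSubInv (br p) β)) γ
        + B (br (cothSubInv (br p) β) (cothSubInv (br p) γ)) α
        + B (br (cothSubInv (br p) γ) (cothSubInv (br p) α)) β + B (br α β) γ := by
  have hsurj := ((Module.End.isUnit_iff _).1 hu).2
  obtain ⟨X, rfl⟩ := hsurj α
  obtain ⟨Y, rfl⟩ := hsurj β
  obtain ⟨Z, rfl⟩ := hsurj γ
  simp only [hQ.form_deriv_cothSubInv hu hα, hQ.form_deriv_cothSubInv hu hβ,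
    hQ.form_deriv_cothSubInv hu hγ, cothSubInv_apply_den hu]
  -- Both sides are now values of elements of the slot algebra of the form `B ⁅X, Y⁆ Z`, and the
  -- equation becomes `divDiff_num_den_identity`. Cyclic symmetry of the form yields the evaluations
  -- with the slots permuted.
  obtain ⟨A, _, _, _, a, b, c, ev, habc, hev⟩ := exists_slotAlgebra (hQ.deriv_trilinear p)
  have hN := isEntire_numCoeff (K := K)
  have hS := isEntire_denCoeff (K := K)
  obtain ⟨rot, hrot⟩ : ∃ rot : TrilinearForm K V →ₗ[K] TrilinearForm K V,
      ∀ σ X Y Z, rot σ Y Z X = σ X Y Z :=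
    ⟨LinearMap.llcomp K V (V →ₗ[K] V →ₗ[K] K) (V →ₗ[K] V →ₗ[K] K) LinearMap.lflip.toLinearMap ∘ₗ
      LinearMap.lflip.toLinearMap, fun σ X Y Z => rfl⟩
  have hev₁ : ∀ (i j k : ℕ) (X Y Z : V), (rot ∘ₗ ev) (b ^ i * c ^ j * a ^ k) X Y Z
      = br.compr₂ B (((br p : End K V) ^ i) X) (((br p : End K V) ^ j) Y)
        (((br p : End K V) ^ k) Z) := fun i j k X Y Z => by
    rw [LinearMap.comp_apply, hrot, mul_comm, ← mul_assoc, hev]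
    exact hQ.cyclic _ _ _
  have hev₂ : ∀ (i j k : ℕ) (X Y Z : V), (rot ∘ₗ rot ∘ₗ ev) (c ^ i * a ^ j * b ^ k) X Y Z
      = br.compr₂ B (((br p : End K V) ^ i) X) (((br p : End K V) ^ j) Y)
        (((br p : End K V) ^ k) Z) := fun i j k X Y Z => by
    rw [LinearMap.comp_apply, LinearMap.comp_apply, hrot, hrot, mul_assoc, mul_comm, hev]
    exact (hQ.cyclic _ _ _).symm
  have h1 := hQ.slot_divDiff hev hS hN hS X Y Z
  have h2 := hQ.slot_divDiff hev hS hS hN X Y Z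
  have h3 := hQ.slot_divDiff hev₁ hS hN hS Y Z X
  have h4 := hQ.slot_divDiff hev₁ hS hS hN Y Z X
  have h5 := hQ.slot_divDiff hev₂ hS hN hS Z X Y
  have h6 := hQ.slot_divDiff hev₂ hS hS hN Z X Y
  have h7 := slot_apply hev hN hN hS X Y Z
  have h8 := slot_apply hev₁ hN hN hS Y Z X
  have h9 := slot_apply hev₂ hN hN hS Z X Y
  have h10 := slot_apply hev hS hS hS X Y Z
  simp only [LinearMap.comp_apply, hrot, LinearMap.compr₂_apply] at h3 h4 h5 h6 h7 h8 h9 h10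
  rw [← h1, ← h2, ← h3, ← h4, ← h5, ← h6, ← h7, ← h8, ← h9, ← h10]
  simp only [← LinearMap.add_apply, ← map_add]
  congr 4
  linear_combination divDiff_num_den_identity (K := K) habc

end IsQuadraticLie

end Quadratic

/-! ### The spectral conditions as invertibility -/

section Spectrum

theorem toComplex_denCoeff (K : Type*) [RCLike K] (n : ℕ) :
    toComplex K (denCoeff K n) = denCoeff ℂ n := by
  unfold denCoeff
  split_ifs <;> simp

theorem continuous_toComplex (K : Type*) [RCLike K] : Continuous (toComplex K) :=
  (RCLike.map K ℂ).toContinuousLinearMap.continuous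

/-- The zeros of `sinh z / z` are the nonzero multiples of `iπ`. -/
theorem evalSeries_denCoeff_complex_eq_zero_iff (z : ℂ) :
    evalSeries (denCoeff ℂ) z = 0 ↔ z ∈ nonzeroMultiplesOfIPi := by
  have hexp : ∀ w : ℂ, evalSeries (expCoeff ℂ) w = Complex.exp w := fun w => by
    rw [evalSeries_eq_tsum, Complex.exp_eq_exp_ℂ, NormedSpace.exp_eq_tsum ℂ]
    rfl
  have hsinh : z * evalSeries (denCoeff ℂ) z = Complex.sinh z := by
    have h1 := evalSeries_expCoeff (K := ℂ) z
    have h2 := evalSeries_expCoeff (K := ℂ) (-z)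
    rw [evalSeries_denCoeff_neg, evalSeries_numCoeff_neg, hexp] at h2
    rw [hexp] at h1
    rw [Complex.sinh]
    linear_combination (h2 - h1) / 2
  have hsin : ∀ k : ℤ, Complex.sinh (Complex.I * Real.pi * k) = 0 := fun k => by
    rw [mul_assoc, mul_comm, Complex.sinh_mul_I, mul_comm (Real.pi : ℂ),
      Complex.sin_int_mul_pi, zero_mul]
  constructor
  · intro h
    have hz : z ≠ 0 := by
      rintro rfl
      rw [evalSeries_zero isEntire_denCoeff] at h
      simp [denCoeff] at h
    rw [h, mul_zero] at hsinh
    have h1 : Complex.sin (z * Complex.I) = 0 := by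
      rw [Complex.sin_mul_I, ← hsinh, zero_mul]
    obtain ⟨k, hk⟩ := Complex.sin_eq_zero_iff.1 h1
    have h2 : z = Complex.I * Real.pi * (-k : ℤ) := by
      push_cast
      linear_combination -Complex.I * hk + z * Complex.I_mul_I
    refine ⟨-k, ?_, h2⟩
    intro h3
    rw [h3] at h2
    exact hz (by simpa using h2)
  · rintro ⟨k, hk, rfl⟩
    rw [hsin] at hsinh
    refine (mul_eq_zero.1 hsinh).resolve_left ?_
    simp [hk, Real.pi_ne_zero]

/-- Spectral mapping for `sinh z / z` over the complex numbers. -/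
theorem isUnit_evalSeries_denCoeff_iff_complex {W : Type*} [AddCommGroup W] [Module ℂ W]
    [FiniteDimensional ℂ W] (f : End ℂ W) :
    IsUnit (evalSeries (denCoeff ℂ) f) ↔
      ∀ z, f.HasEigenvalue z → z ∉ nonzeroMultiplesOfIPi := by
  have hv : ∀ (z : ℂ) (v : W), f v = z • v →
      evalSeries (denCoeff ℂ) f v = evalSeries (denCoeff ℂ) z • v := fun z v h => by
    refine isEntire_denCoeff.map_evalSeries_eq (LinearMap.applyₗ v)
      (LinearMap.toSpanSingleton ℂ W v) fun n => ?_
    change (f ^ n) v = z ^ n • v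
    induction n with
    | zero => simp
    | succ n ih => rw [pow_succ', Module.End.mul_apply, ih, map_smul, h, smul_smul, pow_succ]
  constructor
  · intro hu z hz hmem
    obtain ⟨v, hv1, hv2⟩ := hz.exists_hasEigenvector
    have h1 := hv z v (Module.End.mem_eigenspace_iff.1 hv1)
    rw [(evalSeries_denCoeff_complex_eq_zero_iff z).2 hmem, zero_smul] at h1
    exact hv2 (((Module.End.isUnit_iff _).1 hu).1 (h1.trans (map_zero _).symm))
  · intro h
    rw [LinearMap.isUnit_iff_ker_eq_bot]
    by_contra hne
    let N := LinearMap.ker (evalSeries (denCoeff ℂ) f)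
    have hN : ∀ v ∈ N, f v ∈ N := fun v hv' => by
      have hc : Commute f (evalSeries (denCoeff ℂ) f) :=
        isEntire_denCoeff.commute_evalSeries (Commute.refl f)
      rw [LinearMap.mem_ker] at hv' ⊢
      rw [← Module.End.mul_apply, ← hc.eq, Module.End.mul_apply, hv', map_zero]
    have : Nontrivial N := Submodule.nontrivial_iff_ne_bot.2 hne
    obtain ⟨z, hz⟩ := Module.End.exists_eigenvalue (f.restrict hN)
    obtain ⟨v, hv1, hv2⟩ := hz.exists_hasEigenvector
    have h1 : f v.1 = z • v.1 := congrArg Subtype.val (Module.End.mem_eigenspace_iff.1 hv1)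
    have hv0 : v.1 ≠ 0 := fun h => hv2 (Subtype.ext h)
    refine h z (Module.End.hasEigenvalue_of_hasEigenvector
      ⟨Module.End.mem_eigenspace_iff.2 h1, hv0⟩) ?_
    rw [← evalSeries_denCoeff_complex_eq_zero_iff]
    have h2 := hv z v.1 h1
    rw [LinearMap.mem_ker.1 v.2] at h2
    exact (smul_eq_zero.1 h2.symm).resolve_right hv0

variable {K : Type*} [RCLike K] {V : Type*} [AddCommGroup V] [Module K V] [FiniteDimensional K V]

theorem zero_notMem_complexSpectrum_iff (f : End K V) :
    (0 : ℂ) ∉ complexSpectrum f ↔ IsUnit f := by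
  rw [LinearMap.isUnit_iff_isUnit_det, isUnit_iff_ne_zero, LinearMap.det_eq_sign_charpoly_coeff]
  simp only [complexSpectrum, Set.mem_ofPred_eq, Polynomial.IsRoot,
    ← Polynomial.coeff_zero_eq_eval_zero,
    Polynomial.coeff_map, map_eq_zero]
  simp

/-- The spectral condition on `ad_p` says that the denominator of `F (ad_p)` is invertible. The real
case follows from the complex one by extension of scalars in a matrix algebra. -/
theorem complexSpectrum_inter_eq_empty_iff (f : End K V) :
    complexSpectrum f ∩ nonzeroMultiplesOfIPi = ∅ ↔ IsUnit (evalSeries (denCoeff K) f) := by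
  let n := finrank K V
  let e := LinearMap.toMatrixAlgEquiv (finBasis K V)
  let M : Matrix (Fin n) (Fin n) K := e f
  let φ := toComplex K
  let g : End ℂ (Fin n → ℂ) := Matrix.toLinAlgEquiv' (φ.mapMatrix M)
  have hchar : f.charpoly.map φ = g.charpoly := by
    have h1 : M.charpoly = f.charpoly := LinearMap.charpoly_toMatrix f (finBasis K V)
    have h2 : g.charpoly = (φ.mapMatrix M).charpoly := Matrix.charpoly_toLin' _
    rw [h2, ← h1]
    exact (Matrix.charpoly_map M φ).symm
  have hden : evalSeries (denCoeff ℂ) g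
      = Matrix.toLinAlgEquiv' (φ.mapMatrix (e (evalSeries (denCoeff K) f))) := by
    refine ((isEntire_denCoeff (K := ℂ)).algHom_evalSeries
      (Matrix.toLinAlgEquiv' (R := ℂ) (n := Fin n)).toAlgHom (φ.mapMatrix M)).symm.trans ?_
    refine congrArg (Matrix.toLinAlgEquiv' (R := ℂ) (n := Fin n)) ?_
    ext i j
    have h1 := (isEntire_denCoeff (K := ℂ)).hasSum (φ.mapMatrix M) (Matrix.entryLinearMap ℂ ℂ i j)
    have h2 := ((isEntire_denCoeff (K := K)).hasSum f
      (Matrix.entryLinearMap K K i j ∘ₗ e.toLinearMap)).map φ (continuous_toComplex K)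
    refine h1.unique (h2.congr_fun fun k => ?_)
    change denCoeff ℂ k * (φ.mapMatrix M ^ k) i j = φ (denCoeff K k * (e (f ^ k)) i j)
    rw [map_mul, toComplex_denCoeff, map_pow e, ← map_pow φ.mapMatrix]
    rfl
  have hunit : IsUnit (evalSeries (denCoeff K) f) ↔ IsUnit (evalSeries (denCoeff ℂ) g) := by
    rw [hden, MulEquiv.isUnit_map, Matrix.isUnit_iff_isUnit_det, ← RingHom.map_det,
      isUnit_iff_ne_zero, map_ne_zero, ← isUnit_iff_ne_zero, ← Matrix.isUnit_iff_isUnit_det,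
      MulEquiv.isUnit_map]
  rw [hunit, isUnit_evalSeries_denCoeff_iff_complex, Set.eq_empty_iff_forall_notMem]
  refine forall_congr' fun z => ?_
  rw [Module.End.hasEigenvalue_iff_isRoot_charpoly, ← hchar]
  exact not_and

end Spectrum

/-! ### The double as a quadratic Lie algebra -/

section Double

theorem eq_zero_of_eq_neg {K W : Type*} [RCLike K] [AddCommGroup W] [Module K W] {x : W}
    (h : x = -x) : x = 0 := by
  have h1 : (2 : K) • x = 0 := by rw [two_smul, add_eq_zero_iff_eq_neg]; exact h
  exact (smul_eq_zero.1 h1).resolve_left two_ne_zero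

variable {K : Type*} [RCLike K] {g : Type*} [LieRing g] [LieAlgebra K g]

/-- The canonical symmetric bilinear form on `𝔤 ⊕ 𝔤*`. -/
def doubleForm (K g : Type*) [RCLike K] [LieRing g] [LieAlgebra K g] :
    (g × Dual K g) →ₗ[K] (g × Dual K g) →ₗ[K] K :=
  LinearMap.mk₂ K (fun X Y => Y.2 X.1 + X.2 Y.1)
    (fun X X' Y => by simp; ring) (fun c X Y => by simp [mul_add])
    (fun X Y Y' => by simp; ring) (fun c X Y => by simp [mul_add])

theorem doubleForm_apply (X Y : g × Dual K g) : doubleForm K g X Y = Y.2 X.1 + X.2 Y.1 := rfl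

theorem adStar_apply (x y : g) (ξ : Dual K g) : adStar K x ξ y = ξ ⁅x, y⁆ := rfl

theorem Data.assoc_cyclic (G : Data K g) (ξ η ζ : Dual K g) :
    G.assoc ![ξ, η, ζ] = G.assoc ![η, ζ, ξ] := by
  have h := G.assoc.map_perm ![ξ, η, ζ] (finRotate 3)
  have e : (![ξ, η, ζ] ∘ finRotate 3) = ![η, ζ, ξ] := by
    funext i
    fin_cases i <;> rfl
  rw [e] at h
  simpa using h.symm

/-- The involution of `𝔤 ⊕ 𝔤*` with eigenspaces `𝔤` and `𝔤*`. -/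
def parity (K g : Type*) [RCLike K] [LieRing g] [LieAlgebra K g] : End K (g × Dual K g) :=
  LinearMap.prodMap LinearMap.id (-LinearMap.id)

theorem parity_apply (X : g × Dual K g) : parity K g X = (X.1, -X.2) := rfl

variable [FiniteDimensional K g]

theorem doubleForm_nondegenerate (X : g × Dual K g) (h : ∀ Y, doubleForm K g X Y = 0) : X = 0 := by
  refine Prod.ext (eq_of_forall_dual (K := K) fun ζ => ?_) (LinearMap.ext fun x => ?_)
  · simpa [doubleForm_apply] using h (0, ζ)
  · simpa [doubleForm_apply] using h (x, 0)

namespace Data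

variable (G : Data K g)

theorem doubleBracket_apply (X Y : g × Dual K g) : G.doubleBracket X Y =
    (⁅X.1, Y.1⁆ + G.cocycle X.1 Y.2 - G.cocycle Y.1 X.2 + contract G.assoc X.2 Y.2,
      -adStar K X.1 Y.2 + adStar K Y.1 X.2 + Y.2 ∘ₗ G.cocycle.flip X.2) := rfl

/-- The trilinear form `⟨[X, Y], Z⟩` of the double collects the bracket, `ϖ` and `φ`. -/
theorem doubleForm_doubleBracket (X Y Z : g × Dual K g) :
    doubleForm K g (G.doubleBracket X Y) Z =
      Z.2 ⁅X.1, Y.1⁆ + Z.2 (G.cocycle X.1 Y.2) - Z.2 (G.cocycle Y.1 X.2) + G.assoc ![X.2, Y.2, Z.2]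
        - Y.2 ⁅X.1, Z.1⁆ + X.2 ⁅Y.1, Z.1⁆ + Y.2 (G.cocycle Z.1 X.2) := by
  simp [doubleForm_apply, doubleBracket_apply, adStar_apply, apply_contract]
  ring

variable {G}

theorem IsLieQuasiBialgebra.isQuadraticLie (hG : G.IsLieQuasiBialgebra) :
    IsQuadraticLie G.doubleBracket (doubleForm K g) where
  lie_skew X Y := by
    have h := hG.bracket_self (X + Y)
    simp only [map_add, LinearMap.add_apply, hG.bracket_self, zero_add, add_zero] at h
    exact eq_neg_of_add_eq_zero_right h
  jacobi := hG.jacobi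
  symm X Y := add_comm _ _
  cyclic X Y Z := by
    rw [doubleForm_doubleBracket, doubleForm_doubleBracket, assoc_cyclic]
    have h1 := hG.skew Y.1 Z.2 X.2
    have h2 := hG.skew Z.1 Y.2 X.2
    have h3 : Z.2 ⁅X.1, Y.1⁆ = -Z.2 ⁅Y.1, X.1⁆ := by rw [← lie_skew, map_neg]
    have h4 : Y.2 ⁅X.1, Z.1⁆ = -Y.2 ⁅Z.1, X.1⁆ := by rw [← lie_skew, map_neg]
    linear_combination h3 - h4 - h1 + h2

/-! ### Parity in the double of a cocommutative Lie quasi-bialgebra -/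

section Parity

theorem parity_bracket (h0 : G.cocycle = 0) (p : Dual K g) (X : g × Dual K g) :
    parity K g (G.doubleBracket (0, p) X) = (-G.doubleBracket (0, p)) (parity K g X) := by
  refine Prod.ext (eq_of_forall_dual (K := K) fun ζ => ?_) (LinearMap.ext fun x => ?_)
  · have : G.assoc ![p, -X.2, ζ] = - G.assoc ![p, X.2, ζ] := by
      simpa using alt_smul_snd G.assoc (-1) p X.2 ζ
    simp [parity_apply, doubleBracket_apply, h0, apply_contract, this]
  · simp [parity_apply, doubleBracket_apply, h0, adStar_apply]

theorem parity_evalSeries (h0 : G.cocycle = 0) {a : ℕ → K} (ha : IsEntire a) (p : Dual K g)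
    (X : g × Dual K g) : parity K g (evalSeries a (G.doubleBracket (0, p)) X)
      = evalSeries a (-G.doubleBracket (0, p)) (parity K g X) :=
  ha.intertwine (parity K g) (parity_bracket h0 p) X

variable {p : Dual K g}
  (hu : IsUnit (evalSeries (denCoeff K) (G.doubleBracket (0, p)) : End K (g × Dual K g)))
include hu

theorem exists_evalSeries_denCoeff_eq (h0 : G.cocycle = 0) (α : Dual K g) :
    ∃ β : Dual K g, evalSeries (denCoeff K) (G.doubleBracket (0, p)) (0, β) = (0, α) := by
  obtain ⟨X, hX⟩ := ((Module.End.isUnit_iff _).1 hu).2 ((0, α) : g × Dual K g)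
  have h1 := parity_evalSeries h0 isEntire_denCoeff p X
  rw [hX, evalSeries_denCoeff_neg] at h1
  have h2 : parity K g X = -X := by
    refine ((Module.End.isUnit_iff _).1 hu).1 ?_
    rw [← h1, map_neg, hX]
    simp [parity_apply]
  have h3 : X.1 = 0 := eq_zero_of_eq_neg (K := K) (congrArg Prod.fst h2)
  exact ⟨X.2, by rw [← hX, ← h3]⟩

/-- `F = coth z - 1 / z` is odd, so `F (ad p)` maps `𝔤*` to `𝔤`. -/
theorem cothSubInv_apply (h0 : G.cocycle = 0) (α : Dual K g) :
    cothSubInv (G.doubleBracket (0, p)) (0, α) = (G.rAM p α, 0) := by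
  refine Prod.ext rfl ?_
  obtain ⟨β, hβ⟩ := exists_evalSeries_denCoeff_eq hu h0 α
  have hF : cothSubInv (G.doubleBracket (0, p)) (0, α)
      = evalSeries (numCoeff K) (G.doubleBracket (0, p)) (0, β) := by
    rw [← hβ]
    exact cothSubInv_apply_den hu _
  have h1 := parity_evalSeries h0 isEntire_numCoeff p (0, β)
  rw [evalSeries_numCoeff_neg, ← hF] at h1
  have h2 : parity K g ((0, β) : g × Dual K g) = -(0, β) := by simp [parity_apply]
  rw [h2, LinearMap.neg_apply, map_neg, neg_neg, ← hF] at h1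
  exact eq_zero_of_eq_neg (K := K) (congrArg Prod.snd h1).symm

/-- The function `(1 - exp (-z)) / z - exp (-z) (1 + F z) = 1 / z - 1 / sinh z` is odd. -/
theorem dexp_sub_exp_mem (h0 : G.cocycle = 0) (α : Dual K g) :
    (evalSeries (expSubOneCoeff K) (-G.doubleBracket (0, p)) (0, α)
      - evalSeries (expCoeff K) (-G.doubleBracket (0, p)) (G.rAM p α, α)).2 = 0 := by
  obtain ⟨β, hβ⟩ := exists_evalSeries_denCoeff_eq hu h0 α
  set P : End K (g × Dual K g) := G.doubleBracket (0, p) with hP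
  have hF : ((G.rAM p α, α) : g × Dual K g)
      = (evalSeries (denCoeff K) P + evalSeries (numCoeff K) P) (0, β) := by
    rw [LinearMap.add_apply, hβ, ← cothSubInv_apply_den hu, hβ, cothSubInv_apply hu h0]
    simp
  have h2 : parity K g ((0, β) : g × Dual K g) = -(0, β) := by simp [parity_apply]
  have h3 : ∀ {a : ℕ → K}, IsEntire a → ∀ X, parity K g (evalSeries a P X)
      = evalSeries a (-P) (parity K g X) := fun ha X => parity_evalSeries h0 ha p X
  have h4 : ∀ {a : ℕ → K}, IsEntire a → ∀ X, parity K g (evalSeries a (-P) X)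
      = evalSeries a P (parity K g X) := fun {a} ha X => by
    refine ha.intertwine (f := -P) (f' := P) (parity K g) (fun v => ?_) X
    rw [LinearMap.neg_apply, map_neg, hP, parity_bracket h0, LinearMap.neg_apply, neg_neg]
  have h5 := congrArg (fun T : End K (g × Dual K g) => T (0, β))
    (expSubOne_mul_den_add_neg (K := K) P)
  simp only [LinearMap.add_apply, LinearMap.sub_apply, Module.End.mul_apply, map_add, map_sub] at h5
  suffices h : ∀ X, X = evalSeries (expSubOneCoeff K) (-P) (0, α)
      - evalSeries (expCoeff K) (-P) (G.rAM p α, α) → parity K g X = X from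
    eq_zero_of_eq_neg (K := K) (congrArg Prod.snd (h _ rfl)).symm
  rintro _ rfl
  rw [hF, ← hβ, map_sub, h4 isEntire_expSubOneCoeff, h4 isEntire_expCoeff,
    h3 isEntire_denCoeff, LinearMap.add_apply, map_add, map_add, h3 isEntire_denCoeff,
    h3 isEntire_numCoeff, h2,
    evalSeries_denCoeff_neg, evalSeries_numCoeff_neg]
  simp only [map_neg, LinearMap.neg_apply, neg_neg, map_add]
  linear_combination (norm := module) -h5

end Parity
end Data
end Double

/-! ### Reductive decompositions and the subalgebra `𝔩 ⊕ s 𝔩*` of the double -/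

section Reductive

variable {K : Type*} [RCLike K] {g : Type*} [LieRing g] [LieAlgebra K g]

namespace ReductiveDecomposition

variable (R : ReductiveDecomposition K g)

theorem proj_of_mem_l {x : g} (hx : x ∈ R.l) : R.proj x = ⟨x, hx⟩ :=
  Submodule.projectionOnto_apply_left R.isCompl ⟨x, hx⟩

theorem proj_coe (x : R.l) : R.proj (x : g) = x := R.proj_of_mem_l x.2

theorem proj_eq_zero_iff {x : g} : R.proj x = 0 ↔ x ∈ R.m :=
  Submodule.projectionOnto_apply_eq_zero_iff R.isCompl

theorem sub_proj_mem_m (x : g) : x - R.proj x ∈ R.m := by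
  rw [← R.proj_eq_zero_iff, map_sub, R.proj_coe, sub_self]

theorem proj_lie (x : R.l) (y : g) : R.proj ⁅(x : g), y⁆ = ⁅x, R.proj y⁆ := by
  have h1 : ⁅(x : g), y⁆ = (⁅x, R.proj y⁆ : R.l) + ⁅(x : g), y - R.proj y⁆ := by
    rw [lie_sub, LieSubalgebra.coe_bracket, add_sub_cancel]
  rw [h1, map_add, R.proj_coe, R.proj_eq_zero_iff.2 (R.lie_mem x x.2 _ (R.sub_proj_mem_m y)),
    add_zero]

theorem s_apply (α : Dual K R.l) (x : g) : R.s α x = α (R.proj x) := rfl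

theorem restrict_s (α : Dual K R.l) : restrict R.l (R.s α) = α :=
  LinearMap.ext fun x => congrArg α (R.proj_coe x)

theorem s_mem_mPerp (α : Dual K R.l) : R.s α ∈ R.mPerp :=
  (Submodule.mem_dualAnnihilator _).2 fun x hx => by
    rw [s_apply, R.proj_eq_zero_iff.2 hx, map_zero]

theorem mem_lPerp {ξ : Dual K g} : ξ ∈ R.lPerp ↔ ∀ x : R.l, ξ x = 0 :=
  (Submodule.mem_dualAnnihilator ξ).trans ⟨fun h x => h x x.2, fun h x hx => h ⟨x, hx⟩⟩

theorem sub_s_restrict_mem (ξ : Dual K g) : ξ - R.s (restrict R.l ξ) ∈ R.lPerp :=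
  R.mem_lPerp.2 fun x => by
    change ξ x - ξ (R.proj (x : g)) = 0
    rw [R.proj_coe, sub_self]

theorem eq_s_of_mem_mPerp {ξ : Dual K g} (hξ : ξ ∈ R.mPerp) : ξ = R.s (restrict R.l ξ) :=
  LinearMap.ext fun x => by
    change ξ x = ξ (R.proj x : g)
    rw [← sub_eq_zero, ← map_sub]
    exact (Submodule.mem_dualAnnihilator ξ).1 hξ _ (R.sub_proj_mem_m x)

theorem adStar_s (z : R.l) (α : Dual K R.l) : adStar K (z : g) (R.s α) = R.s (adStar K z α) :=
  LinearMap.ext fun x => by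
    change α (R.proj ⁅(z : g), x⁆) = α ⁅z, R.proj x⁆
    rw [R.proj_lie]

theorem adStar_mem_lPerp (z : R.l) {ξ : Dual K g} (hξ : ξ ∈ R.lPerp) :
    adStar K (z : g) ξ ∈ R.lPerp :=
  R.mem_lPerp.2 fun x => R.mem_lPerp.1 hξ ⁅z, x⁆

/-- The embedding of `𝔩 ⊕ 𝔩*` into `𝔤 ⊕ 𝔤*` by the inclusion and `s`. -/
def embed : (R.l × Dual K R.l) →ₗ[K] (g × Dual K g) :=
  LinearMap.prodMap R.l.toSubmodule.subtype R.s

theorem embed_apply (X : R.l × Dual K R.l) : R.embed X = ((X.1 : g), R.s X.2) := rfl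

theorem embed_injective : Function.Injective R.embed := fun X Y h => by
  refine Prod.ext (Subtype.ext (congrArg Prod.fst h)) ?_
  have h2 := congrArg (fun Z : g × Dual K g => restrict R.l Z.2) h
  simpa only [embed_apply, R.restrict_s] using h2

theorem doubleForm_embed (X Y : R.l × Dual K R.l) :
    doubleForm K g (R.embed X) (R.embed Y) = doubleForm K R.l X Y := by
  simp [doubleForm_apply, embed_apply, s_apply, R.proj_coe]

/-- The subspace `𝔪 ⊕ 𝔩^⊥` of the double. -/
def complement : Submodule K (g × Dual K g) := R.m.prod R.lPerp

theorem mem_complement_iff {X : g × Dual K g} [FiniteDimensional K g] :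
    X ∈ R.complement ↔ ∀ Y, doubleForm K g (R.embed Y) X = 0 := by
  constructor
  · rintro ⟨h1, h2⟩ Y
    rw [doubleForm_apply, embed_apply, R.mem_lPerp.1 h2, s_apply, R.proj_eq_zero_iff.2 h1]
    simp
  · intro h
    refine ⟨R.proj_eq_zero_iff.1 (eq_of_forall_dual (K := K) fun α => ?_),
      R.mem_lPerp.2 fun x => ?_⟩
    · simpa [doubleForm_apply, embed_apply, s_apply] using h (0, α)
    · simpa [doubleForm_apply, embed_apply] using h (x, 0)

end ReductiveDecomposition

open ReductiveDecomposition

namespace Data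

variable [FiniteDimensional K g] {G : Data K g} {R : ReductiveDecomposition K g}

/-- The double of `(𝔩, [ , ], 0, p_𝔩^{(3)} φ)` is the subalgebra `𝔩 ⊕ s 𝔩*` of `𝔡`. -/
theorem doubleBracket_embed (hc : G.IsCompatible R) (X Y : R.l × Dual K R.l) :
    G.doubleBracket (R.embed X) (R.embed Y) = R.embed ((G.onL R).doubleBracket X Y) := by
  obtain ⟨x, α⟩ := X
  obtain ⟨y, β⟩ := Y
  have h1 : contract G.assoc (R.s α) (R.s β) = (contract (G.onL R).assoc α β : R.l) := by
    refine eq_of_forall_dual (K := K) fun ζ => ?_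
    have h2 := hc.assoc_llm _ (R.s_mem_mPerp α) _ (R.s_mem_mPerp β) _ (R.sub_s_restrict_mem ζ)
    have h3 := alt_add_trd G.assoc (R.s α) (R.s β) (ζ - R.s (restrict R.l ζ))
      (R.s (restrict R.l ζ))
    rw [sub_add_cancel, h2, zero_add] at h3
    have h4 := apply_contract (G.onL R).assoc α β (restrict R.l ζ)
    rw [apply_contract, h3]
    refine Eq.trans ?_ h4.symm
    change _ = G.assoc _
    congr 1
    funext i
    fin_cases i <;> rfl
  refine Prod.ext ?_ (LinearMap.ext fun u => ?_)
  · simp only [doubleBracket_apply, embed_apply, hc.cocycle_l _ x.2, hc.cocycle_l _ y.2, h1]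
    simp [onL]
  · have h5 : R.s β (G.cocycle u (R.s α)) = 0 :=
      hc.cocycle_mPerp u _ (R.s_mem_mPerp β) _ (R.s_mem_mPerp α)
    simp only [doubleBracket_apply, embed_apply, adStar_s]
    simp [h5, onL, s_apply]

theorem onL_isLieQuasiBialgebra (hG : G.IsLieQuasiBialgebra) (hc : G.IsCompatible R) :
    (G.onL R).IsLieQuasiBialgebra where
  skew x ξ η := by simp [onL]
  cocycle_lie x y ξ := by simp [onL]
  bracket_self X := R.embed_injective (by rw [← doubleBracket_embed hc, hG.bracket_self, map_zero])
  jacobi X Y Z := R.embed_injective (by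
    simp only [map_add, ← doubleBracket_embed hc, hG.jacobi, map_zero])

/-- `𝔪 ⊕ 𝔩^⊥` is the orthogonal complement of `𝔩 ⊕ s 𝔩*`, hence stable under it. -/
theorem doubleBracket_embed_mem (hG : G.IsLieQuasiBialgebra) (hc : G.IsCompatible R)
    (X : R.l × Dual K R.l) {Y : g × Dual K g} (hY : Y ∈ R.complement) :
    G.doubleBracket (R.embed X) Y ∈ R.complement := by
  rw [mem_complement_iff] at hY ⊢
  intro Z
  have h := hG.isQuadraticLie.form_skew (R.embed X) (R.embed Z) Y
  rw [doubleBracket_embed hc, hY] at h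
  exact neg_eq_zero.1 h.symm

end Data
end Reductive

/-! ### The canonical ℓ-matrix and its graph -/

section Canonical

variable {K : Type*} [RCLike K] {g : Type*} [LieRing g] [LieAlgebra K g] [FiniteDimensional K g]
  {G : Data K g} {R : ReductiveDecomposition K g} {p : Dual K R.l}

namespace Data

open ReductiveDecomposition

theorem mem_domain_iff : p ∈ G.domain R ↔
    IsUnit (evalSeries (denCoeff K) ((G.onL R).doubleBracket (0, p)) : End K (R.l × Dual K R.l)) ∧
      IsUnit (G.adBlock R p) :=
  and_congr (complexSpectrum_inter_eq_empty_iff _) (zero_notMem_complexSpectrum_iff _)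

theorem adExp_mem_complement (hG : G.IsLieQuasiBialgebra) (hc : G.IsCompatible R)
    (p : Dual K R.l) {Y : g × Dual K g} (hY : Y ∈ R.complement) :
    G.adExp (0, -R.s p) Y ∈ R.complement := by
  refine isEntire_expCoeff.evalSeries_mem (fun Y hY => ?_) hY
  have h := doubleBracket_embed_mem hG hc (0, -p) hY
  rwa [embed_apply, map_neg] at h

theorem adBlock_apply (p : Dual K R.l) (x : g) :
    G.adBlock R p x = (G.adExp (0, -R.s p) (x, 0)).1 := rfl

theorem adExp_fst (p : Dual K R.l) (X : g × Dual K g) : (G.adExp (0, -R.s p) X).1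
    = G.adBlock R p X.1 + (G.adExp (0, -R.s p) (0, X.2)).1 := by
  rw [adBlock_apply, ← Prod.fst_add, ← map_add]
  simp

theorem ringInverse_adBlock_mem (hG : G.IsLieQuasiBialgebra) (hc : G.IsCompatible R)
    (hu : IsUnit (G.adBlock R p)) {x : g} (hx : x ∈ R.m) :
    Ring.inverse (G.adBlock R p) x ∈ R.m := by
  have hm : ∀ x ∈ R.m, G.adBlock R p x ∈ R.m := fun x hx =>
    (adExp_mem_complement hG hc p (Y := (x, 0)) ⟨hx, zero_mem _⟩).1
  have hinj : Function.Injective ((G.adBlock R p).restrict hm) := fun x y h =>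
    Subtype.ext (((Module.End.isUnit_iff _).1 hu).1 (congrArg Subtype.val h))
  obtain ⟨y, hy⟩ := LinearMap.injective_iff_surjective.1 hinj ⟨x, hx⟩
  have hy' : G.adBlock R p y = x := congrArg Subtype.val hy
  rw [← hy', ← Module.End.mul_apply, Ring.inverse_mul_cancel _ hu]
  exact y.2

theorem lcan_s (G : Data K g) (R : ReductiveDecomposition K g) (p α : Dual K R.l) :
    G.lcan R p (R.s α) = ((G.onL R).rAM p α : g) := by
  have h := G.lcan_apply R p α 0 (zero_mem _)
  have h0 : ((0, 0) : g × Dual K g) = 0 := rfl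
  rwa [h0, map_zero, Prod.fst_zero, map_zero, add_zero, sub_zero] at h

theorem lcan_of_mem_lPerp (G : Data K g) (R : ReductiveDecomposition K g) (p : Dual K R.l)
    {ξ : Dual K g} (hξ : ξ ∈ R.lPerp) : G.lcan R p ξ
      = -Ring.inverse (G.adBlock R p) (G.adExp (0, -R.s p) (0, ξ)).1 := by
  have h := G.lcan_apply R p 0 ξ hξ
  rwa [map_zero, map_zero, zero_add, ZeroMemClass.coe_zero, zero_sub] at h

theorem lcan_mem_m (hG : G.IsLieQuasiBialgebra) (hc : G.IsCompatible R)
    (hu : IsUnit (G.adBlock R p)) {ξ : Dual K g} (hξ : ξ ∈ R.lPerp) : G.lcan R p ξ ∈ R.m := by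
  rw [lcan_of_mem_lPerp G R p hξ]
  exact neg_mem (ringInverse_adBlock_mem hG hc hu
    (adExp_mem_complement hG hc p (Y := (0, ξ)) ⟨zero_mem _, hξ⟩).1)

theorem adExp_lcan_fst (hu : IsUnit (G.adBlock R p)) {ξ : Dual K g} (hξ : ξ ∈ R.lPerp) :
    (G.adExp (0, -R.s p) (G.lcan R p ξ, ξ)).1 = 0 := by
  rw [adExp_fst, lcan_of_mem_lPerp G R p hξ, map_neg, ← Module.End.mul_apply,
    Ring.mul_inverse_cancel _ hu, Module.End.one_apply, neg_add_cancel]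

/-- Over `𝔩^⊥`, the graph of the canonical ℓ-matrix is `Ad_{exp (s p)} 𝔩^⊥`. -/
theorem adExp_lcan (hG : G.IsLieQuasiBialgebra) (hc : G.IsCompatible R)
    (hu : IsUnit (G.adBlock R p)) {ξ : Dual K g} (hξ : ξ ∈ R.lPerp) :
    ∃ ξ₀ ∈ R.lPerp, G.adExp (0, -R.s p) (G.lcan R p ξ, ξ) = (0, ξ₀) :=
  ⟨_, (adExp_mem_complement hG hc p (Y := (G.lcan R p ξ, ξ)) ⟨lcan_mem_m hG hc hu hξ, hξ⟩).2,
    Prod.ext (adExp_lcan_fst hu hξ) rfl⟩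

theorem graph_s (G : Data K g) (R : ReductiveDecomposition K g) (p α : Dual K R.l) :
    (G.lcan R p (R.s α), R.s α) = R.embed ((G.onL R).rAM p α, α) := by
  rw [lcan_s]; rfl

theorem graph_mem_complement (hG : G.IsLieQuasiBialgebra) (hc : G.IsCompatible R)
    (hu : IsUnit (G.adBlock R p)) {ξ : Dual K g} (hξ : ξ ∈ R.lPerp) :
    (G.lcan R p ξ, ξ) ∈ R.complement :=
  ⟨lcan_mem_m hG hc hu hξ, hξ⟩

theorem isCompatibleOn_lcan (hG : G.IsLieQuasiBialgebra) (hc : G.IsCompatible R) :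
    IsCompatibleOn R (G.domain R) (G.lcan R) := fun p hp =>
  ⟨fun ξ hξ => by
    rw [R.eq_s_of_mem_mPerp hξ, lcan_s]
    exact Subtype.mem _, fun ξ hξ => lcan_mem_m hG hc (mem_domain_iff.1 hp).2 hξ⟩

theorem rAM_skew (hG : G.IsLieQuasiBialgebra) (hc : G.IsCompatible R) (hp : p ∈ G.domain R)
    (α β : Dual K R.l) : β ((G.onL R).rAM p α) = -α ((G.onL R).rAM p β) := by
  have hu := (mem_domain_iff.1 hp).1
  have hQ := (onL_isLieQuasiBialgebra hG hc).isQuadraticLie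
  obtain ⟨γ, hγ⟩ := exists_evalSeries_denCoeff_eq hu rfl β
  have h := hQ.form_mul_inverse (0, p) (0, α) (0, γ) hu
  rw [← cothSubInv_apply_den hu, hγ, cothSubInv_apply hu rfl, cothSubInv_apply hu rfl] at h
  simpa [doubleForm_apply] using h

theorem form_embed_complement {X : R.l × Dual K R.l} {Y : g × Dual K g} (hY : Y ∈ R.complement) :
    doubleForm K g (R.embed X) Y = 0 := (R.mem_complement_iff.1 hY) X

theorem form_complement_embed {X : R.l × Dual K R.l} {Y : g × Dual K g} (hY : Y ∈ R.complement) :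
    doubleForm K g Y (R.embed X) = 0 := by
  rw [doubleForm_apply, add_comm]
  exact form_embed_complement hY

/-- The graph of the canonical ℓ-matrix is split by `𝔤* = s 𝔩* ⊕ 𝔩^⊥`. -/
theorem lcan_add_graph (ξ : Dual K g) : (G.lcan R p ξ, ξ)
    = R.embed ((G.onL R).rAM p (restrict R.l ξ), restrict R.l ξ)
      + (G.lcan R p (ξ - R.s (restrict R.l ξ)), ξ - R.s (restrict R.l ξ)) := by
  rw [← graph_s, Prod.mk_add_mk, ← map_add, add_sub_cancel]

theorem isSkew_lcan (hG : G.IsLieQuasiBialgebra) (hc : G.IsCompatible R) (hp : p ∈ G.domain R) :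
    IsSkew (G.lcan R p) := by
  have hu := (mem_domain_iff.1 hp).2
  intro ξ η
  suffices h : doubleForm K g (G.lcan R p ξ, ξ) (G.lcan R p η, η) = 0 by
    rw [doubleForm_apply] at h
    exact eq_neg_of_add_eq_zero_right h
  rw [lcan_add_graph ξ, lcan_add_graph η]
  obtain ⟨ξ₀, -, hξ⟩ := adExp_lcan hG hc hu (R.sub_s_restrict_mem ξ)
  obtain ⟨η₀, -, hη⟩ := adExp_lcan hG hc hu (R.sub_s_restrict_mem η)
  have h1 := hG.isQuadraticLie.form_exp (0, -R.s p)
    (G.lcan R p (ξ - R.s (restrict R.l ξ)), ξ - R.s (restrict R.l ξ))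
    (G.lcan R p (η - R.s (restrict R.l η)), η - R.s (restrict R.l η))
  change doubleForm K g (G.adExp _ _) (G.adExp _ _) = _ at h1
  rw [hξ, hη] at h1
  rw [map_add, map_add, LinearMap.add_apply, LinearMap.add_apply, ← h1,
    form_embed_complement (graph_mem_complement hG hc hu (R.sub_s_restrict_mem η)),
    form_complement_embed (graph_mem_complement hG hc hu (R.sub_s_restrict_mem ξ)),
    doubleForm_embed]
  simp [doubleForm_apply, rAM_skew hG hc hp (restrict R.l ξ) (restrict R.l η)]

/-! ### Analyticity -/

section Analytic

variable {E : Type*} [NormedAddCommGroup E] [NormedSpace K E] {q : E → Dual K R.l} {x : E}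

theorem wAnalyticAt_bracket_onL (hq : WAnalyticAt K q x) :
    WAnalyticAt K (fun y => ((G.onL R).doubleBracket (0, q y) : End K (R.l × Dual K R.l))) x :=
  hq.linear ((G.onL R).doubleBracket ∘ₗ LinearMap.inr K R.l (Dual K R.l))

theorem wAnalyticAt_adExp (hq : WAnalyticAt K q x) :
    WAnalyticAt K (fun y => G.adExp (0, -R.s (q y))) x :=
  (hq.linear (W₁ := End K (g × Dual K g))
    (G.doubleBracket ∘ₗ LinearMap.inr K g (Dual K g) ∘ₗ (-R.s))).evalSeries isEntire_expCoeff

theorem wAnalyticAt_adBlock (hq : WAnalyticAt K q x) :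
    WAnalyticAt K (fun y => G.adBlock R (q y)) x :=
  (wAnalyticAt_adExp (G := G) hq).linear (W₁ := End K g)
    (LinearMap.llcomp K g (g × Dual K g) g (LinearMap.fst K g (Dual K g)) ∘ₗ
      LinearMap.lcomp K (g × Dual K g) (LinearMap.inl K g (Dual K g)))

theorem wAnalyticAt_cothSubInv (hq : WAnalyticAt K q x) (hx : q x ∈ G.domain R) :
    WAnalyticAt K (fun y => cothSubInv ((G.onL R).doubleBracket (0, q y))) x :=
  (wAnalyticAt_bracket_onL hq).cothSubInv (mem_domain_iff.1 hx).1

theorem wAnalyticAt_lcan (hq : WAnalyticAt K q x) (hx : q x ∈ G.domain R) :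
    WAnalyticAt K (fun y => G.lcan R (q y)) x := by
  have h1 := (wAnalyticAt_cothSubInv hq hx).linear (W₁ := Dual K g →ₗ[K] g)
    (LinearMap.llcomp K (Dual K g) (R.l × Dual K R.l) g
      (R.l.toSubmodule.subtype ∘ₗ LinearMap.fst K R.l (Dual K R.l)) ∘ₗ
      LinearMap.lcomp K (R.l × Dual K R.l) (LinearMap.inr K R.l (Dual K R.l) ∘ₗ restrict R.l))
  have h2 := (wAnalyticAt_adExp (G := G) hq).linear (W₁ := Dual K g →ₗ[K] g)
    (LinearMap.llcomp K (Dual K g) (g × Dual K g) g (LinearMap.fst K g (Dual K g)) ∘ₗ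
      LinearMap.lcomp K (g × Dual K g) (LinearMap.inr K g (Dual K g) ∘ₗ
        (LinearMap.id - R.s ∘ₗ restrict R.l)))
  have h3 := ((wAnalyticAt_adBlock (G := G) hq).ringInverse (mem_domain_iff.1 hx).2).bilinear h2
    (LinearMap.llcomp K (Dual K g) g g)
  exact h1.sub h3

theorem isOpen_preimage_domain (hq : ∀ x, WAnalyticAt K q x) : IsOpen (q ⁻¹' G.domain R) := by
  have h : q ⁻¹' G.domain R
      = {x | IsUnit (evalSeries (denCoeff K) ((G.onL R).doubleBracket (0, q x)) :
          End K (R.l × Dual K R.l))} ∩ {x | IsUnit (G.adBlock R (q x))} :=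
    Set.ext fun x => mem_domain_iff
  rw [h]
  exact (isOpen_setOf_isUnit fun x =>
    (wAnalyticAt_bracket_onL (hq x)).evalSeries isEntire_denCoeff).inter
    (isOpen_setOf_isUnit fun x => wAnalyticAt_adBlock (hq x))

end Analytic

theorem wAnalyticAt_equivFun_symm {W : Type*} [AddCommGroup W] [Module K W]
    [FiniteDimensional K W] (x : Fin (finrank K W) → K) :
    WAnalyticAt K (finBasis K W).equivFun.symm x := fun w =>
  (LinearMap.toContinuousLinearMap (w ∘ₗ (finBasis K W).equivFun.symm.toLinearMap)).analyticAt x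

theorem isOpenSet_domain : IsOpenSet (K := K) (G.domain R) := by
  have h := isOpen_preimage_domain (G := G) (R := R) wAnalyticAt_equivFun_symm
  unfold IsOpenSet
  let _ : TopologicalSpace (Dual K R.l) := moduleTopology K (Dual K R.l)
  have : IsModuleTopology K (Dual K R.l) := ⟨rfl⟩
  have : ContinuousAdd (Dual K R.l) := IsModuleTopology.toContinuousAdd K _
  have : ContinuousSMul K (Dual K R.l) := IsModuleTopology.toContinuousSMul K _
  have hc : Continuous (finBasis K (Dual K R.l)).equivFun :=
    IsModuleTopology.continuous_of_linearMap (finBasis K (Dual K R.l)).equivFun.toLinearMap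
  have h2 := h.preimage hc
  rw [← Set.preimage_comp] at h2
  simpa [Function.comp_def] using h2

theorem isAnalyticOn_lcan : IsAnalyticOn (K := K) (G.lcan R) (G.domain R) := fun w x hx =>
  wAnalyticAt_lcan (wAnalyticAt_equivFun_symm x) hx w

theorem isSmoothOn_lcan : IsSmoothOn (K := K) (G.lcan R) (G.domain R) := fun w =>
  (isAnalyticOn_lcan (G := G) (R := R) w).contDiffOn
    (isOpen_preimage_domain wAnalyticAt_equivFun_symm).uniqueDiffOn

theorem adExp_zero (G : Data K g) (R : ReductiveDecomposition K g) :
    G.adExp (0, -R.s 0) = 1 := by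
  have h0 : ((0, -R.s 0) : g × Dual K g) = 0 := by rw [map_zero, neg_zero]; rfl
  rw [h0]
  change evalSeries (expCoeff K) (G.doubleBracket 0) = 1
  rw [map_zero, evalSeries_zero isEntire_expCoeff]
  simp [expCoeff]

theorem zero_mem_domain : 0 ∈ G.domain R := by
  rw [mem_domain_iff]
  have h0 : ((0, 0) : R.l × Dual K R.l) = 0 := rfl
  constructor
  · rw [h0, map_zero, evalSeries_zero isEntire_denCoeff]
    simp [denCoeff]
  · have h1 : G.adBlock R 0 = 1 := LinearMap.ext fun x => by
      rw [adBlock_apply, adExp_zero]; rfl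
    rw [h1]
    exact isUnit_one

theorem lcan_zero : G.lcan R 0 = 0 := by
  have h0 : ((0, 0) : R.l × Dual K R.l) = 0 := rfl
  have h1 : cothSubInv (0 : End K (R.l × Dual K R.l)) = 0 := by
    change evalSeries (numCoeff K) (0 : End K (R.l × Dual K R.l)) * _ = 0
    rw [evalSeries_zero isEntire_numCoeff]
    simp [numCoeff]
  have h2 : (G.onL R).rAM 0 = 0 := by
    rw [rAM, h0, map_zero, h1]
    rfl
  refine LinearMap.ext fun ξ => ?_
  have h3 : G.adExp (0, 0) = 1 := by simpa using adExp_zero G R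
  simp [lcan, h2, h3]

end Data
end Canonical

/-! ### Coadjoint invariance of the domain -/

section Invariance

variable {K : Type*} [RCLike K] {g : Type*} [LieRing g] [LieAlgebra K g] [FiniteDimensional K g]
  {G : Data K g} {R : ReductiveDecomposition K g} {p : Dual K R.l}

/-- Entire functions of `ad` are equivariant under the automorphism `exp (ad W)`. -/
theorem IsQuadraticLie.evalSeries_exp_apply {V : Type*} [AddCommGroup V] [Module K V]
    [FiniteDimensional K V] {br : V →ₗ[K] V →ₗ[K] V} {B : V →ₗ[K] V →ₗ[K] K}
    (hQ : IsQuadraticLie br B) (hB : ∀ X, (∀ Y, B X Y = 0) → X = 0) {a : ℕ → K} (ha : IsEntire a)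
    (W X Y : V) :
    evalSeries (expCoeff K) (br W) (evalSeries a (br X) Y)
      = evalSeries a (br (evalSeries (expCoeff K) (br W) X)) (evalSeries (expCoeff K) (br W) Y) :=
  ha.intertwine (evalSeries (expCoeff K) (br W)) (fun Y => hQ.exp_bracket hB W X Y) Y

theorem isUnit_evalSeries_expCoeff {A : Type*} [Ring A] [Algebra K A] [FiniteDimensional K A]
    (x : A) : IsUnit (evalSeries (expCoeff K) x) := by
  have h1 := evalSeries_expCoeff_mul_neg (K := K) x
  have h2 := evalSeries_expCoeff_mul_neg (K := K) (-x)
  rw [neg_neg] at h2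
  exact ⟨⟨_, _, h1, h2⟩, rfl⟩

theorem isUnit_of_conj {A : Type*} [Ring A] {u x y : A} (hu : IsUnit u) (h : u * x = y * u)
    (hx : IsUnit x) : IsUnit y := by
  obtain ⟨u, rfl⟩ := hu
  have : y = u * x * ↑u⁻¹ := by rw [h, mul_assoc, Units.mul_inv, mul_one]
  rw [this]
  exact (u.isUnit.mul hx).mul (u⁻¹).isUnit

namespace Data

open ReductiveDecomposition

/-- The adjoint action of `z` on a double in which `ϖ_z` vanishes. -/
theorem doubleBracket_inl {z : g} (hz : G.cocycle z = 0) (X : g × Dual K g) :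
    G.doubleBracket (z, 0) X = (⁅z, X.1⁆, -adStar K z X.2) := by
  refine Prod.ext (eq_of_forall_dual (K := K) fun ζ => ?_) (LinearMap.ext fun y => ?_)
  · have := G.assoc.map_coord_zero (m := ![0, X.2, ζ]) 0 rfl
    simp [doubleBracket_apply, apply_contract, this, hz]
  · simp [doubleBracket_apply]

theorem isCoadjointInvariant_domain (hG : G.IsLieQuasiBialgebra) (hc : G.IsCompatible R) :
    IsCoadjointInvariant R.l (G.domain R) := by
  intro z p hp
  rw [mem_domain_iff] at hp ⊢
  have hL := (onL_isLieQuasiBialgebra hG hc).isQuadraticLie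
  have hz : G.cocycle (-(z : g)) = 0 := by rw [map_neg, hc.cocycle_l _ z.2, neg_zero]
  have hzL : (G.onL R).cocycle (-z) = 0 := rfl
  have h1 : ∀ q, ((0, expEnd (adStar K z) q) : R.l × Dual K R.l)
      = evalSeries (expCoeff K) ((G.onL R).doubleBracket (-z, 0)) (0, q) := fun q => by
    refine isEntire_expCoeff.intertwine (LinearMap.inr K R.l (Dual K R.l)) (fun q => ?_) q
    rw [doubleBracket_inl hzL]
    simp [adStar, LinearMap.dualMap_def]
  have he : R.embed (-z, 0) = (-(z : g), 0) := by simp [embed_apply]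
  have h2 : ((0, -R.s (expEnd (adStar K z) p)) : g × Dual K g)
      = evalSeries (expCoeff K) (G.doubleBracket (-(z : g), 0)) (0, -R.s p) := by
    have h := isEntire_expCoeff.intertwine R.embed
      (fun X => (doubleBracket_embed hc (-z, 0) X).symm) (0, -p)
    have hn : ((0, -p) : R.l × Dual K R.l) = -(0, p) := by simp
    rw [he, hn, map_neg, ← h1] at h
    simpa [embed_apply] using h
  constructor
  · rw [h1]
    exact isUnit_of_conj (isUnit_evalSeries_expCoeff (K := K)
      ((G.onL R).doubleBracket (-z, 0) : End K _)) (LinearMap.ext fun Y =>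
        hL.evalSeries_exp_apply doubleForm_nondegenerate isEntire_denCoeff _ _ _) hp.1
  · refine isUnit_of_conj (isUnit_evalSeries_expCoeff (K := K)
      (LieAlgebra.ad K g (-(z : g)) : End K g)) (LinearMap.ext fun x => ?_) hp.2
    have h3 : ∀ x, ((evalSeries (expCoeff K) (LieAlgebra.ad K g (-(z : g)) : End K g) x, 0) :
        g × Dual K g) = evalSeries (expCoeff K) (G.doubleBracket (-(z : g), 0)) (x, 0) := fun x =>
      isEntire_expCoeff.intertwine (LinearMap.inl K g (Dual K g))
        (fun x => by rw [LinearMap.inl_apply, LinearMap.inl_apply, doubleBracket_inl hz]; simp) x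
    have h4 : ∀ X : g × Dual K g, (evalSeries (expCoeff K) (G.doubleBracket (-(z : g), 0)) X).1
        = evalSeries (expCoeff K) (LieAlgebra.ad K g (-(z : g)) : End K g) X.1 := fun X =>
      isEntire_expCoeff.intertwine (LinearMap.fst K g (Dual K g))
        (fun X => by rw [LinearMap.fst_apply, LinearMap.fst_apply, doubleBracket_inl hz]; rfl) X
    have h5 := hG.isQuadraticLie.evalSeries_exp_apply doubleForm_nondegenerate isEntire_expCoeff
      (-(z : g), 0) (0, -R.s p) (x, 0)
    rw [← h2, ← h3] at h5
    have h6 := congrArg Prod.fst h5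
    rw [h4] at h6
    exact h6

end Data
end Invariance

/-! ### Derivatives of the canonical ℓ-matrix -/

section Derivative

theorem HasWDerivAt.eq_zero {K : Type*} [RCLike K] {W : Type*} [AddCommGroup W] [Module K W]
    {c : K → W} {c' : W} {t : K} (h : HasWDerivAt c c' t) (h0 : ∀ᶠ s in 𝓝 t, c s = 0) : c' = 0 :=
  h.unique fun w => (HasWDerivAt.const 0 t w).congr_of_eventuallyEq
    (h0.mono fun _ hs => congrArg w hs)

/-- The derivative of `a (x)` in the direction of a commutator `[x, z]` is `[a (x), z]`. -/
theorem divDiff_commutator {K : Type*} [RCLike K] {A : Type*} [Ring A] [Algebra K A]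
    [FiniteDimensional K A] {a : ℕ → K} (ha : IsEntire a) (x z : A) :
    divDiff a x (x * z - z * x) x = evalSeries a x * z - z * evalSeries a x := by
  refine ha.map_evalSeries_eq (x := !![x, x * z - z * x; 0, x])
    (Matrix.entryLinearMap K A (0 : Fin 2) (1 : Fin 2))
    (LinearMap.mulRight K z - LinearMap.mulLeft K z) fun n => ?_
  have h : !![x, x * z - z * x; 0, x] ^ n = !![x ^ n, x ^ n * z - z * x ^ n; 0, x ^ n] := by
    induction n with
    | zero => simp [Matrix.one_fin_two]
    | succ n ih =>
      rw [pow_succ, ih, Matrix.mul_fin_two]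
      congr 1
      simp only [pow_succ]
      noncomm_ring
  rw [h]
  simp

variable {K : Type*} [RCLike K] {g : Type*} [LieRing g] [LieAlgebra K g] [FiniteDimensional K g]
  {G : Data K g} {R : ReductiveDecomposition K g} {p v : Dual K R.l}
  {L' : Dual K g →ₗ[K] g}

namespace Data

open ReductiveDecomposition

theorem exists_hasWDerivAt_lcan (hp : p ∈ G.domain R) (v : Dual K R.l) :
    ∃ L' : Dual K g →ₗ[K] g, HasWDerivAt (fun t : K => G.lcan R (p + t • v)) L' 0 :=
  (wAnalyticAt_lcan (q := fun t : K => p + t • v) (wAnalyticAt_add_smul_const p v 0)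
    (by simpa using hp)).exists_hasWDerivAt

theorem exists_hasWDerivAt_cothSubInv (hp : p ∈ G.domain R) (v : Dual K R.l) :
    ∃ F' : End K (R.l × Dual K R.l), HasWDerivAt
      (fun t : K => cothSubInv ((G.onL R).doubleBracket ((0, p) + t • (0, v)))) F' 0 := by
  have h := (wAnalyticAt_cothSubInv (q := fun t : K => p + t • v)
    (wAnalyticAt_add_smul_const p v 0) (by simpa using hp)).exists_hasWDerivAt
  simpa using h

theorem eventually_mem_domain (hp : p ∈ G.domain R) (v : Dual K R.l) :
    ∀ᶠ t in 𝓝 (0 : K), p + t • v ∈ G.domain R :=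
  (isOpen_preimage_domain (G := G) (R := R) fun t =>
    wAnalyticAt_add_smul_const p v t).mem_nhds (by simpa using hp)

theorem lineDeriv_lcan (hL : HasWDerivAt (fun t : K => G.lcan R (p + t • v)) L' 0)
    (η ζ : Dual K g) : lineDeriv K (fun q => ζ (G.lcan R q η)) p v = ζ (L' η) :=
  (hL (ζ ∘ₗ LinearMap.applyₗ η)).deriv

theorem deriv_lcan_s (hL : HasWDerivAt (fun t : K => G.lcan R (p + t • v)) L' 0)
    {F' : End K (R.l × Dual K R.l)} (hF : HasWDerivAt
      (fun t : K => cothSubInv ((G.onL R).doubleBracket ((0, p) + t • (0, v)))) F' 0)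
    (β : Dual K R.l) : L' (R.s β) = ((F' (0, β)).1 : g) := by
  have h1 := hL.linear (LinearMap.applyₗ (R.s β))
  have h2 := hF.linear (R.l.toSubmodule.subtype ∘ₗ LinearMap.fst K R.l (Dual K R.l) ∘ₗ
    LinearMap.applyₗ ((0, β) : R.l × Dual K R.l))
  refine h1.unique ?_
  convert h2 using 2 with t
  swap
  · rfl
  have h3 : ((0, p) + t • (0, v) : R.l × Dual K R.l) = (0, p + t • v) := by simp
  rw [h3]
  exact lcan_s G R (p + t • v) β

theorem deriv_lcan_mem_m (hG : G.IsLieQuasiBialgebra) (hc : G.IsCompatible R)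
    (hp : p ∈ G.domain R) (hL : HasWDerivAt (fun t : K => G.lcan R (p + t • v)) L' 0)
    {ξ : Dual K g} (hξ : ξ ∈ R.lPerp) : L' ξ ∈ R.m := by
  rw [← R.proj_eq_zero_iff]
  refine (hL.linear (R.proj ∘ₗ LinearMap.applyₗ ξ)).eq_zero ?_
  filter_upwards [eventually_mem_domain hp v] with t ht
  exact R.proj_eq_zero_iff.2 ((isCompatibleOn_lcan hG hc _ ht).2 ξ hξ)

/-- The derivative of the equation `(Ad_{exp (-s p)} (l_p ξ + ξ))_𝔤 = 0` that defines the canonical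
ℓ-matrix on `𝔩^⊥`. -/
theorem deriv_adExp_lcan (hp : p ∈ G.domain R)
    (hL : HasWDerivAt (fun t : K => G.lcan R (p + t • v)) L' 0) {ξ : Dual K g}
    (hξ : ξ ∈ R.lPerp) :
    (divDiff (expCoeff K) (G.doubleBracket (0, -R.s p)) (G.doubleBracket (0, -R.s v))
      (G.doubleBracket (0, -R.s p)) (G.lcan R p ξ, ξ)).1
      + (G.adExp (0, -R.s p) (L' ξ, 0)).1 = 0 := by
  have h1 := hasWDerivAt_evalSeries (isEntire_expCoeff (K := K))
    (G.doubleBracket (0, -R.s p) : End K _) (G.doubleBracket (0, -R.s v))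
  have h2 := ((hL.linear (LinearMap.applyₗ ξ)).linear (LinearMap.inl K g (Dual K g))).add
    (HasWDerivAt.const ((0, ξ) : g × Dual K g) 0)
  have h3 := (h1.bilinear h2 LinearMap.id).linear (LinearMap.fst K g (Dual K g))
  have h4 := h3.eq_zero (by
    filter_upwards [eventually_mem_domain hp v] with t ht
    have h5 : (evalSeries (expCoeff K) (G.doubleBracket (0, -R.s (p + t • v)))
      (G.lcan R (p + t • v) ξ, ξ)).1 = 0 := adExp_lcan_fst (mem_domain_iff.1 ht).2 hξ
    have h6 : G.doubleBracket (0, -R.s p) + t • G.doubleBracket (0, -R.s v)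
        = G.doubleBracket (0, -R.s (p + t • v)) := by
      rw [← map_smul, ← map_add]
      simp [add_comm]
    rw [h6]
    simpa using h5)
  have h7 : G.adExp (0, -R.s p) = evalSeries (expCoeff K) (G.doubleBracket (0, -R.s p)) := rfl
  rw [h7]
  simpa using h4

end Data
end Derivative

/-! ### The dynamical Yang-Baxter equation -/

section YangBaxter

variable {K : Type*} [RCLike K] {g : Type*} [LieRing g] [LieAlgebra K g] [FiniteDimensional K g]
  {G : Data K g} {R : ReductiveDecomposition K g} {p v : Dual K R.l}
  {L' : Dual K g →ₗ[K] g}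

namespace Data

open ReductiveDecomposition

/-- With `Q = ad_{-s p}`, the vectors `((exp Q - 1) / Q) (s α)` and `exp Q (l_p (s α) + s α)` differ
by an element of `𝔩`. -/
theorem exists_dexp_sub_adExp (hc : G.IsCompatible R) (hp : p ∈ G.domain R) (α : Dual K R.l) :
    ∃ z : R.l, evalSeries (expSubOneCoeff K) (G.doubleBracket (0, -R.s p)) (0, R.s α)
      - G.adExp (0, -R.s p) (G.lcan R p (R.s α), R.s α) = ((z : g), 0) := by
  have h := dexp_sub_exp_mem (mem_domain_iff.1 hp).1 rfl α
  have hint : ∀ {a : ℕ → K}, IsEntire a → ∀ X,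
      R.embed (evalSeries a (-(G.onL R).doubleBracket (0, p)) X)
        = evalSeries a (G.doubleBracket (0, -R.s p)) (R.embed X) := fun ha X => by
    refine ha.intertwine (f := -(G.onL R).doubleBracket (0, p)) R.embed (fun X => ?_) X
    have h1 := doubleBracket_embed hc (0, -p) X
    have h2 : ((0, -p) : R.l × Dual K R.l) = -(0, p) := by simp
    have h3 : R.embed (0, -p) = (0, -R.s p) := by simp [embed_apply]
    rw [h3, h2, map_neg] at h1
    exact h1.symm
  set X := evalSeries (expSubOneCoeff K) (-(G.onL R).doubleBracket (0, p)) (0, α)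
      - evalSeries (expCoeff K) (-(G.onL R).doubleBracket (0, p)) ((G.onL R).rAM p α, α) with hX
  refine ⟨X.1, ?_⟩
  have h3 : R.embed X = ((X.1 : g), 0) := by rw [embed_apply, h, map_zero]
  rw [← h3, hX, map_sub, hint isEntire_expSubOneCoeff, hint isEntire_expCoeff, ← graph_s]
  rfl

/-- The mixed component of the dynamical Yang-Baxter equation, in `𝔩 ⊗ 𝔪 ⊗ 𝔪`. -/
theorem deriv_lcan_lPerp (hG : G.IsLieQuasiBialgebra) (hc : G.IsCompatible R)
    (hp : p ∈ G.domain R) (hL : HasWDerivAt (fun t : K => G.lcan R (p + t • v)) L' 0)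
    {ξ η : Dual K g} (hξ : ξ ∈ R.lPerp) (hη : η ∈ R.lPerp) :
    η (L' ξ) = doubleForm K g (G.doubleBracket (G.lcan R p (R.s v), R.s v) (G.lcan R p ξ, ξ))
      (G.lcan R p η, η) := by
  have hQ := hG.isQuadraticLie
  have hu := (mem_domain_iff.1 hp).2
  obtain ⟨ξ₀, -, h1⟩ := adExp_lcan hG hc hu hξ
  obtain ⟨η₀, -, h2⟩ := adExp_lcan hG hc hu hη
  obtain ⟨z, hz⟩ := exists_dexp_sub_adExp hc hp v
  -- Pairing `h3` with the image of the graph vector of `η` isolates `η (L' ξ)`, as the form is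
  -- invariant; `h4` evaluates the divided difference.
  have h3 := deriv_adExp_lcan hp hL hξ
  have h4 := hQ.form_divDiff_exp (0, -R.s p) (0, -R.s v) (G.lcan R p ξ, ξ)
    (G.adExp (0, -R.s p) (G.lcan R p η, η))
  have h5 := hQ.form_exp (0, -R.s p) (L' ξ, 0) (G.lcan R p η, η)
  have h6 := exp_invariant (hQ.deriv_trilinear (0, -R.s p)) (G.lcan R p (R.s v), R.s v)
    (G.lcan R p ξ, ξ) (G.lcan R p η, η)
  change doubleForm K g (G.adExp _ _) (G.adExp _ _) = _ at h5
  change doubleForm K g (G.doubleBracket (G.adExp _ _) (G.adExp _ _)) (G.adExp _ _)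
    = doubleForm K g (G.doubleBracket _ _) _ at h6
  change _ = doubleForm K g (G.doubleBracket _ (G.adExp _ _)) _ at h4
  have h7 : ((0, -R.s v) : g × Dual K g) = -(0, R.s v) := by simp
  rw [h7, map_neg (evalSeries _ _), sub_eq_iff_eq_add.1 hz, h1, h2] at h4
  rw [h1, h2] at h6
  rw [h2] at h5
  -- The correction from `exists_dexp_sub_adExp` contributes `⟨η₀, ϖ_z ξ₀⟩`.
  have h8 : doubleForm K g (G.doubleBracket ((z : g), 0) (0, ξ₀)) (0, η₀) = 0 := by
    have := G.assoc.map_coord_zero (m := ![0, ξ₀, η₀]) 0 rfl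
    simp [doubleForm_doubleBracket, hc.cocycle_l _ z.2, this]
  have h9 := congrArg η₀ h3
  rw [← h6]
  simp only [doubleForm_apply (Y := ((0 : g), η₀)), map_zero, add_zero, map_add] at h4 h5 h8 h9 ⊢
  simp only [doubleForm_apply] at h5
  simp only [map_neg, map_add, LinearMap.neg_apply, LinearMap.add_apply, Prod.fst_add,
    Prod.fst_neg, h8, h7] at h4 h5 h9 ⊢
  simp at h5
  linear_combination -h5 - h4 + h9

/-- The component of the dynamical Yang-Baxter equation in `∧³𝔩`, which is the equation for the
Alekseev-Meinrenken r-matrix of `𝔩`. -/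
theorem form_graph_s (hG : G.IsLieQuasiBialgebra) (hc : G.IsCompatible R)
    (hp : p ∈ G.domain R) {α β γ : Dual K R.l} {L₁ L₂ L₃ : Dual K g →ₗ[K] g}
    (h₁ : HasWDerivAt (fun t : K => G.lcan R (p + t • α)) L₁ 0)
    (h₂ : HasWDerivAt (fun t : K => G.lcan R (p + t • β)) L₂ 0)
    (h₃ : HasWDerivAt (fun t : K => G.lcan R (p + t • γ)) L₃ 0) :
    doubleForm K g (G.doubleBracket (G.lcan R p (R.s α), R.s α) (G.lcan R p (R.s β), R.s β))
      (G.lcan R p (R.s γ), R.s γ)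
      = R.s γ (L₁ (R.s β)) + R.s α (L₂ (R.s γ)) + R.s β (L₃ (R.s α)) := by
  have hu := (mem_domain_iff.1 hp).1
  obtain ⟨F₁, f₁⟩ := exists_hasWDerivAt_cothSubInv hp α
  obtain ⟨F₂, f₂⟩ := exists_hasWDerivAt_cothSubInv hp β
  obtain ⟨F₃, f₃⟩ := exists_hasWDerivAt_cothSubInv hp γ
  have h := (onL_isLieQuasiBialgebra hG hc).isQuadraticLie.alekseevMeinrenken hu f₁ f₂ f₃
  simp only [cothSubInv_apply hu rfl] at h
  rw [deriv_lcan_s h₁ f₁, deriv_lcan_s h₂ f₂, deriv_lcan_s h₃ f₃, graph_s, graph_s, graph_s,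
    doubleBracket_embed hc, doubleForm_embed]
  have h0 : ∀ ζ, (G.onL R).assoc ![0, 0, ζ] = 0 := fun ζ =>
    (G.onL R).assoc.map_coord_zero (m := ![0, 0, ζ]) 0 rfl
  have hc0 : (G.onL R).cocycle = 0 := rfl
  simp only [doubleForm_doubleBracket, hc0, h0, s_apply, R.proj_coe] at h ⊢
  simp only [doubleForm_apply, LinearMap.zero_apply, map_zero, lie_zero, add_zero,
    sub_zero, zero_add] at h ⊢
  have h4 : β ⁅(G.onL R).rAM p α, (G.onL R).rAM p γ⁆
      = -β ⁅(G.onL R).rAM p γ, (G.onL R).rAM p α⁆ := by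
    rw [← lie_skew, map_neg]
  linear_combination -h - h4

/-- The dynamical Yang-Baxter equation in terms of the graph of the canonical ℓ-matrix in the
double. -/
theorem form_graph (hG : G.IsLieQuasiBialgebra) (hcc : G.IsCanonicallyCompatible R)
    (hp : p ∈ G.domain R) {ξ η ζ : Dual K g} {L₁ L₂ L₃ : Dual K g →ₗ[K] g}
    (h₁ : HasWDerivAt (fun t : K => G.lcan R (p + t • restrict R.l ξ)) L₁ 0)
    (h₂ : HasWDerivAt (fun t : K => G.lcan R (p + t • restrict R.l η)) L₂ 0)
    (h₃ : HasWDerivAt (fun t : K => G.lcan R (p + t • restrict R.l ζ)) L₃ 0) :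
    doubleForm K g (G.doubleBracket (G.lcan R p ξ, ξ) (G.lcan R p η, η)) (G.lcan R p ζ, ζ)
      = ζ (L₁ η) + ξ (L₂ ζ) + η (L₃ ξ) := by
  have hc := hcc.toIsCompatible
  have hQ := hG.isQuadraticLie
  have hu := (mem_domain_iff.1 hp).2
  have hsum : ∀ ξ, ∃ α, ∃ ξ' ∈ R.lPerp, ξ = R.s α + ξ' ∧ restrict R.l ξ = α := fun ξ =>
    ⟨_, _, R.sub_s_restrict_mem ξ, (add_sub_cancel _ _).symm, rfl⟩
  obtain ⟨α, ξ', hξ, rfl, hα⟩ := hsum ξ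
  obtain ⟨β, η', hη, rfl, hβ⟩ := hsum η
  obtain ⟨γ, ζ', hζ, rfl, hγ⟩ := hsum ζ
  rw [hα] at h₁
  rw [hβ] at h₂
  rw [hγ] at h₃
  -- The derivatives are block diagonal for `𝔤* = s 𝔩* ⊕ 𝔩^⊥` and `𝔤 = 𝔩 ⊕ 𝔪`.
  have hblock : ∀ {v : Dual K R.l} {L : Dual K g →ₗ[K] g},
      HasWDerivAt (fun t : K => G.lcan R (p + t • v)) L 0 → ∀ (β γ : Dual K R.l) (η ζ : Dual K g),
      η ∈ R.lPerp → ζ ∈ R.lPerp →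
        (R.s γ + ζ) (L (R.s β + η)) = R.s γ (L (R.s β)) + ζ (L η) := by
    intro v L hL β γ η ζ hη hζ
    obtain ⟨F, f⟩ := exists_hasWDerivAt_cothSubInv hp v
    have e1 : ζ (L (R.s β)) = 0 := by rw [deriv_lcan_s hL f]; exact R.mem_lPerp.1 hζ _
    have e2 : R.s γ (L η) = 0 := by
      rw [s_apply, R.proj_eq_zero_iff.2 (deriv_lcan_mem_m hG hc hp hL hη), map_zero]
    simp [e1, e2]
  -- `Ad_{exp (-s p)}` moves the graph over `𝔩^⊥` to `𝔩^⊥` itself.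
  have hmmm : doubleForm K g (G.doubleBracket (G.lcan R p ξ', ξ') (G.lcan R p η', η'))
      (G.lcan R p ζ', ζ') = 0 := by
    obtain ⟨ξ₀, m1, e1⟩ := adExp_lcan hG hc hu hξ
    obtain ⟨η₀, m2, e2⟩ := adExp_lcan hG hc hu hη
    obtain ⟨ζ₀, m3, e3⟩ := adExp_lcan hG hc hu hζ
    have h6 := exp_invariant (hQ.deriv_trilinear (0, -R.s p)) (G.lcan R p ξ', ξ')
      (G.lcan R p η', η') (G.lcan R p ζ', ζ')
    change doubleForm K g (G.doubleBracket (G.adExp _ _) (G.adExp _ _)) (G.adExp _ _)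
      = doubleForm K g (G.doubleBracket _ _) _ at h6
    rw [← h6, e1, e2, e3, doubleForm_doubleBracket]
    simp [hcc.assoc_mod_l _ m1 _ m2 _ m3]
  have e : ∀ α ξ, ((G.lcan R p (R.s α + ξ), R.s α + ξ) : g × Dual K g)
      = (G.lcan R p (R.s α), R.s α) + (G.lcan R p ξ, ξ) := fun α ξ => by
    rw [map_add, Prod.mk_add_mk]
  -- `𝔩 ⊕ s 𝔩*` is a subalgebra of the double, orthogonal to the graph over `𝔩^⊥`.
  have hllm : ∀ (α β : Dual K R.l) {ζ : Dual K g}, ζ ∈ R.lPerp →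
      doubleForm K g (G.doubleBracket (G.lcan R p (R.s α), R.s α) (G.lcan R p (R.s β), R.s β))
        (G.lcan R p ζ, ζ) = 0 := fun α β ζ hζ => by
    rw [graph_s, graph_s, doubleBracket_embed hc]
    exact form_embed_complement (graph_mem_complement hG hc hu hζ)
  rw [hblock h₁ _ _ _ _ hη hζ, hblock h₂ _ _ _ _ hζ hξ, hblock h₃ _ _ _ _ hξ hη,
    deriv_lcan_lPerp hG hc hp h₁ hη hζ, deriv_lcan_lPerp hG hc hp h₂ hζ hξ,
    deriv_lcan_lPerp hG hc hp h₃ hξ hη, e α, e β, e γ]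
  have hlll := form_graph_s hG hc hp h₁ h₂ h₃
  have c1 := hllm α β hζ
  have c2 := hllm β γ hξ
  have c3 := hllm γ α hη
  simp only [map_add, LinearMap.add_apply]
  rw [hlll, hmmm, c1,
    hQ.cyclic (G.lcan R p (R.s α), R.s α) (G.lcan R p η', η') (G.lcan R p (R.s γ), R.s γ),
    hQ.cyclic (G.lcan R p η', η') (G.lcan R p (R.s γ), R.s γ) (G.lcan R p (R.s α), R.s α), c3,
    hQ.cyclic (G.lcan R p ξ', ξ') (G.lcan R p (R.s β), R.s β) (G.lcan R p (R.s γ), R.s γ), c2,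
    hQ.cyclic (G.lcan R p ξ', ξ') (G.lcan R p (R.s β), R.s β) (G.lcan R p ζ', ζ'),
    hQ.cyclic (G.lcan R p ξ', ξ') (G.lcan R p η', η') (G.lcan R p (R.s γ), R.s γ),
    hQ.cyclic (G.lcan R p η', η') (G.lcan R p (R.s γ), R.s γ) (G.lcan R p ξ', ξ')]
  ring

theorem lcan_yangBaxter (hG : G.IsLieQuasiBialgebra) (hcc : G.IsCanonicallyCompatible R)
    (hp : p ∈ G.domain R) (ξ η ζ : Dual K g) :
    cyclicSum (fun ξ η ζ : Dual K g =>
      lineDeriv K (fun q => ζ (G.lcan R q η)) p (restrict R.l ξ)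
        - ζ ⁅G.lcan R p ξ, G.lcan R p η⁆ - ζ (G.cocycle (G.lcan R p ξ) η)) ξ η ζ
      = G.assoc ![ξ, η, ζ] := by
  obtain ⟨L₁, h₁⟩ := exists_hasWDerivAt_lcan hp (restrict R.l ξ)
  obtain ⟨L₂, h₂⟩ := exists_hasWDerivAt_lcan hp (restrict R.l η)
  obtain ⟨L₃, h₃⟩ := exists_hasWDerivAt_lcan hp (restrict R.l ζ)
  have h := form_graph hG hcc hp h₁ h₂ h₃
  simp only [cyclicSum, lineDeriv_lcan h₁, lineDeriv_lcan h₂, lineDeriv_lcan h₃]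
  rw [doubleForm_doubleBracket] at h
  have h4 : η ⁅G.lcan R p ξ, G.lcan R p ζ⁆ = -η ⁅G.lcan R p ζ, G.lcan R p ξ⁆ := by
    rw [← lie_skew, map_neg]
  have h5 := hG.skew (G.lcan R p η) ζ ξ
  linear_combination -h - h4 - h5

end Data
end YangBaxter

/-! ### Equivariance -/

section Equivariance

variable {K : Type*} [RCLike K] {g : Type*} [LieRing g] [LieAlgebra K g] [FiniteDimensional K g]
  {G : Data K g} {R : ReductiveDecomposition K g} {p : Dual K R.l}
  {L' : Dual K g →ₗ[K] g}

/-- The derivative of `F (f)` in the direction of a commutator `[f, z]` is `[F (f), z]`. -/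
theorem HasWDerivAt.cothSubInv_commutator {V : Type*} [AddCommGroup V] [Module K V]
    [FiniteDimensional K V] {f z F' : End K V}
    (hF : HasWDerivAt (fun t : K => cothSubInv (f + t • (f * z - z * f))) F' 0)
    (hu : IsUnit (evalSeries (denCoeff K) f)) : F' = cothSubInv f * z - z * cothSubInv f := by
  have h := hF.cothSubInv_mul_den hu
  rw [divDiff_commutator isEntire_denCoeff, divDiff_commutator isEntire_numCoeff,
    ← LieQuasi.cothSubInv_mul_den hu] at h
  refine hu.mul_right_cancel ?_
  rw [eq_sub_of_add_eq h]
  noncomm_ring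

namespace Data

open ReductiveDecomposition

/-- `ad_{ad*_z ξ} = [ad_ξ, ad_z]` in the double, so that moving `ξ` along its coadjoint orbit
changes functions of `ad_ξ` by commutators. -/
theorem doubleBracket_inr_adStar (hG : G.IsLieQuasiBialgebra) {z : g} (hz : G.cocycle z = 0)
    (ξ : Dual K g) : (G.doubleBracket (0, adStar K z ξ) : End K (g × Dual K g))
      = (G.doubleBracket (0, ξ) : End K (g × Dual K g)) * G.doubleBracket (z, 0)
        - (G.doubleBracket (z, 0) : End K (g × Dual K g)) * G.doubleBracket (0, ξ) := by
  refine LinearMap.ext fun Y => ?_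
  have h := hG.isQuadraticLie.leibniz (z, 0) (0, ξ) Y
  have h1 : G.doubleBracket (z, 0) (0, ξ) = -(0, adStar K z ξ) := by
    rw [doubleBracket_inl hz]; simp
  rw [h1, map_neg, LinearMap.neg_apply] at h
  rw [LinearMap.sub_apply, Module.End.mul_apply, Module.End.mul_apply, h]
  abel

theorem lcan_equivariant_s (hG : G.IsLieQuasiBialgebra) (hc : G.IsCompatible R)
    (hp : p ∈ G.domain R) (z : R.l)
    (hL : HasWDerivAt (fun t : K => G.lcan R (p + t • adStar K z p)) L' 0) (β : Dual K R.l) :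
    L' (R.s β) + ⁅(z : g), G.lcan R p (R.s β)⁆ + G.lcan R p (adStar K (z : g) (R.s β)) = 0 := by
  have hu := (mem_domain_iff.1 hp).1
  have hz : (G.onL R).cocycle z = 0 := rfl
  obtain ⟨F, f⟩ := exists_hasWDerivAt_cothSubInv hp (adStar K z p)
  have hlin : ∀ t : K,
      (G.onL R).doubleBracket ((0, p) + t • (0, adStar K z p))
      = (G.onL R).doubleBracket (0, p) + t • (G.onL R).doubleBracket (0, adStar K z p) :=
    fun t => by
    rw [map_add, map_smul]
  rw [deriv_lcan_s hL f]
  simp only [hlin, doubleBracket_inr_adStar (onL_isLieQuasiBialgebra hG hc) hz] at f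
  rw [f.cothSubInv_commutator hu, adStar_s, lcan_s, lcan_s, LinearMap.sub_apply,
    Module.End.mul_apply, Module.End.mul_apply, cothSubInv_apply hu rfl, doubleBracket_inl hz,
    doubleBracket_inl hz, lie_zero]
  have h0 : ((0, -adStar K z β) : R.l × Dual K R.l) = -(0, adStar K z β) := by simp
  simp only [h0, map_neg, cothSubInv_apply hu rfl]
  simp

theorem lcan_equivariant_lPerp (hG : G.IsLieQuasiBialgebra) (hc : G.IsCompatible R)
    (hp : p ∈ G.domain R) (z : R.l)
    (hL : HasWDerivAt (fun t : K => G.lcan R (p + t • adStar K z p)) L' 0) {ξ : Dual K g}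
    (hξ : ξ ∈ R.lPerp) :
    L' ξ + ⁅(z : g), G.lcan R p ξ⁆ + G.lcan R p (adStar K (z : g) ξ) = 0 := by
  have hu := (mem_domain_iff.1 hp).2
  have hz := hc.cocycle_l _ z.2
  obtain ⟨ξ₀, -, h1⟩ := adExp_lcan hG hc hu hξ
  have h2 := deriv_adExp_lcan hp hL hξ
  have h3 := adExp_lcan_fst hu (R.adStar_mem_lPerp z hξ)
  have h4 : -R.s (adStar K z p) = adStar K (z : g) (-R.s p) := by rw [map_neg, adStar_s]
  rw [h4, doubleBracket_inr_adStar hG hz, divDiff_commutator isEntire_expCoeff] at h2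
  change (G.adExp _ (G.doubleBracket _ _) - G.doubleBracket _ (G.adExp _ _)).1 + _ = 0 at h2
  rw [h1, doubleBracket_inl hz, doubleBracket_inl hz, lie_zero, Prod.fst_sub, sub_zero] at h2
  refine ((Module.End.isUnit_iff _).1 hu).1 ?_
  have h5 : ((L' ξ + ⁅(z : g), G.lcan R p ξ⁆ + G.lcan R p (adStar K (z : g) ξ), 0) :
      g × Dual K g) = (⁅(z : g), G.lcan R p ξ⁆, -adStar K (z : g) ξ) + (L' ξ, 0)
        + (G.lcan R p (adStar K (z : g) ξ), adStar K (z : g) ξ) := by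
    rw [Prod.mk_add_mk, Prod.mk_add_mk, add_zero, neg_add_cancel, add_comm (L' ξ)]
  rw [map_zero, adBlock_apply, h5, map_add, map_add, Prod.fst_add, Prod.fst_add, h2, h3, add_zero]

theorem lcan_equivariant (hG : G.IsLieQuasiBialgebra) (hc : G.IsCompatible R)
    (hp : p ∈ G.domain R) (z : R.l) (ξ ζ : Dual K g) :
    lineDeriv K (fun q => ζ (G.lcan R q ξ)) p (adStar K z p)
      + ζ (G.cocycle (z : g) ξ) + ζ ⁅(z : g), G.lcan R p ξ⁆
      + ζ (G.lcan R p (adStar K (z : g) ξ)) = 0 := by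
  obtain ⟨L', hL⟩ := exists_hasWDerivAt_lcan hp (adStar K z p)
  have h1 := lcan_equivariant_s hG hc hp z hL (restrict R.l ξ)
  have h2 := lcan_equivariant_lPerp hG hc hp z hL (R.sub_s_restrict_mem ξ)
  have h3 : L' ξ + ⁅(z : g), G.lcan R p ξ⁆ + G.lcan R p (adStar K (z : g) ξ) = 0 := by
    have h := congrArg₂ (· + ·) h1 h2
    simp only [map_sub, lie_sub, add_zero] at h
    rw [← h]
    abel
  rw [lineDeriv_lcan hL, hc.cocycle_l _ z.2, LinearMap.zero_apply, map_zero, add_zero, ← map_add,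
    ← map_add, h3, map_zero]

end Data
end Equivariance

end LieQuasi

end

open LieQuasi LieQuasi.Data in
theorem mainTheorem1 {K : Type*} [RCLike K] {g : Type*} [LieRing g] [LieAlgebra K g]
    [FiniteDimensional K g] (R : LieQuasi.ReductiveDecomposition K g) (G : LieQuasi.Data K g)
    (hG : G.IsLieQuasiBialgebra) (hc : G.IsCanonicallyCompatible R) :
    (G.onL R).IsLieQuasiBialgebra ∧
    LieQuasi.IsOpenSet (K := K) (G.domain R) ∧
    LieQuasi.IsCoadjointInvariant R.l (G.domain R) ∧
    0 ∈ G.domain R ∧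
    LieQuasi.IsDynamicalLMatrix G R.l (G.domain R) (G.lcan R) ∧
    LieQuasi.IsAnalyticOn (K := K) (G.lcan R) (G.domain R) ∧
    G.lcan R 0 = 0 ∧
    LieQuasi.IsCompatibleOn R (G.domain R) (G.lcan R) := by
  have hc' := hc.toIsCompatible
  exact ⟨onL_isLieQuasiBialgebra hG hc', isOpenSet_domain, isCoadjointInvariant_domain hG hc',
    zero_mem_domain,
    { isOpen := isOpenSet_domain
      invariant := isCoadjointInvariant_domain hG hc'
      skew := fun p hp => isSkew_lcan hG hc' hp
      smooth := isSmoothOn_lcan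
      yangBaxter := fun p hp => lcan_yangBaxter hG hc hp
      equivariant := fun p hp => lcan_equivariant hG hc' hp },
    isAnalyticOn_lcan, lcan_zero, isCompatibleOn_lcan hG hc'⟩
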